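/- Let $\rho$ be a $d$-dimensional quantum state (for instance a state of $N$ qubits, $d=2^N$) and let $O_1,\dots,O_M\in\mathbb C^{d\times d}$ be Hermitian observables, $M\ge 1$. Write $\|A\|_{HS}=\sqrt{\operatorname{Tr}[A^\dagger A]}$. \emph{Algorithm (robust classical shadows).} Given $n$ copies of $\rho$, for each copy $i\in\{1,\dots,n\}$ independently sample a Haar-random unitary $U_i$, apply $U_i$ to the copy and measure in the computational basis; the outcome $b_i$ then has probability $\langle b_i|U_i\rho U_i^\dagger|b_i\rangle$. This gives records $x_i=(U_i,b_i)$. From records $y_1,\dots,y_n$ with $y_i=(U_i',b_i')$, form $|v_i\rangle=U_i'^\dagger|b_i'\rangle$ and the classical shadows $\hat\rho_i=(d+1)|v_i\rangle\langle v_i|-\mathbb I_d$, and, for each $j$, output as $E_j$ the $2\gamma$-truncated mean of $\operatorname{Tr}[O_j\hat\rho_1],\dots,\operatorname{Tr}[O_j\hat\rho_n]$, i.e. the average of the values that remain after the $\lfloor 2\gamma n\rfloor$ smallest and the $\lfloor 2\gamma n\rfloor$ largest ones are discarded. \emph{$\gamma$-adversarial corruption.} The algorithm does not receive the honest records $x_1,\dots,x_n$,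 but records $y_1,\dots,y_n$ produced by a possibly randomized adversary who knows everything about $x_1,\dots,x_n$ (and $\rho$, the $O_j$ and the algorithm) and replaces at most $\gamma n$ of the records by arbitrary ones. \textbf{Theorem.} There are universal constants $C_1,C_2>0$ such that the following holds for all $d$, all $M\ge 1$, all $0<\gamma<1/4$, all $0<\delta<1$ with $M/\delta\ge 2$, all Hermitian $O_1,\dots,O_M\in\mathbb C^{d\times d}$, all states $\rho$, and every number of copies \[ n\ \ge\ C_1\,\frac{\log(M/\delta)}{\gamma^2}. \] Against every $\gamma$-corruption adversary, with probability at least $1-\delta$ over the random unitaries, the measurement outcomes and the adversary's randomness, the outputs of the algorithm satisfy \[ |E_i-\operatorname{Tr}[O_i\rho]|\ \le\ C_2\,\gamma\log(1/\gamma)\,\max_{1\le j\le M}\|O_j\|_{HS}\qquad\text{for all } i=1,\dots,M. \] In particular $n=O(\log(M/\delta)/\gamma^2)$ copies suffice. -/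

import Mathlib

open MeasureTheory ProbabilityTheory
open scoped ComplexOrder

/-- The Hilbert-Schmidt norm `√(Tr[Aᴴ A])` of a complex matrix. -/
noncomputable def hsNorm {d : ℕ} (A : Matrix (Fin d) (Fin d) ℂ) : ℝ :=
  Real.sqrt (A.conjTranspose * A).trace.re

/-- A `d`-dimensional quantum state (density matrix): positive semidefinite with trace one. -/
def IsDensityMatrix {d : ℕ} (ρ : Matrix (Fin d) (Fin d) ℂ) : Prop :=
  ρ.PosSemidef ∧ ρ.trace = 1

/-! ### Haar measure on the unitary group -/

noncomputable instance unitaryGroupMeasurableSpace (d : ℕ) :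
    MeasurableSpace (Matrix.unitaryGroup (Fin d) ℂ) := borel _

instance unitaryGroupBorelSpace (d : ℕ) :
    BorelSpace (Matrix.unitaryGroup (Fin d) ℂ) := ⟨rfl⟩

theorem unitaryGroup_isCompact (d : ℕ) :
    IsCompact (Matrix.unitaryGroup (Fin d) ℂ : Set (Matrix (Fin d) (Fin d) ℂ)) := by
  have hK : IsCompact (Set.univ.pi fun _ : Fin d => Set.univ.pi fun _ : Fin d =>
      Metric.closedBall (0 : ℂ) 1) :=
    isCompact_univ_pi fun _ => isCompact_univ_pi fun _ => isCompact_closedBall 0 1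
  refine IsCompact.of_isClosed_subset hK ?_ ?_
  · have h : (Matrix.unitaryGroup (Fin d) ℂ : Set (Matrix (Fin d) (Fin d) ℂ)) =
        {A | A * star A = 1} := by
      ext A
      exact Matrix.mem_unitaryGroup_iff
    rw [h]
    exact isClosed_eq (by fun_prop) continuous_const
  · intro A hA i _ j _
    simpa using entry_norm_bound_of_unitary hA i j

instance unitaryGroupCompactSpace (d : ℕ) :
    CompactSpace (Matrix.unitaryGroup (Fin d) ℂ) :=
  isCompact_iff_compactSpace.mp (unitaryGroup_isCompact d)

/-- The Haar probability measure on the group of `d × d` unitary matrices. -/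
noncomputable def haarUnitary (d : ℕ) : Measure (Matrix.unitaryGroup (Fin d) ℂ) :=
  Measure.haarMeasure ⊤

/-! ### Haar-random basis measurement of a single copy -/

/-- The classical record of one measurement: the unitary `U` that was sampled and the
computational basis label `b` that was observed. -/
abbrev ShadowRecord (d : ℕ) : Type := Matrix.unitaryGroup (Fin d) ℂ × Fin d

/-- Born's rule: the probability `⟨b| U ρ U† |b⟩` of observing `b` when `U` is applied to `ρ`
and the result is measured in the computational basis. -/
noncomputable def bornProb {d : ℕ} (ρ : Matrix (Fin d) (Fin d) ℂ) (x : ShadowRecord d) : ℝ :=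
  ((x.1 : Matrix (Fin d) (Fin d) ℂ) * ρ *
    (x.1 : Matrix (Fin d) (Fin d) ℂ).conjTranspose) x.2 x.2 |>.re

/-- The law of the record of one copy of `ρ`: `U` is Haar distributed, and given `U` the label
`b` has probability `⟨b| U ρ U† |b⟩`. It is given by its density with respect to
the product of the Haar measure and the counting measure. -/
noncomputable def recordLaw {d : ℕ} (ρ : Matrix (Fin d) (Fin d) ℂ) : Measure (ShadowRecord d) :=
  ((haarUnitary d).prod Measure.count).withDensity fun x => ENNReal.ofReal (bornProb ρ x)

/-- The outcome vector `|v⟩ = U† |b⟩` of a record. -/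
noncomputable def outcomeVector {d : ℕ} (x : ShadowRecord d) : Fin d → ℂ :=
  (x.1 : Matrix (Fin d) (Fin d) ℂ).conjTranspose.mulVec (Pi.single x.2 1)

/-- The classical shadow `(d + 1) |v⟩⟨v| - 𝕀` of a record. -/
noncomputable def classicalShadow {d : ℕ} (x : ShadowRecord d) : Matrix (Fin d) (Fin d) ℂ :=
  ((d : ℂ) + 1) • Matrix.vecMulVec (outcomeVector x) (star (outcomeVector x)) - 1

/-! ### Adversarial corruption -/

/-- `y` is a `γ`-corruption of `x`: at most a `γ`-fraction of the `n` entries was changed,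
each to an arbitrary value. -/
def IsCorruption {α : Type*} {n : ℕ} (γ : ℝ) (x y : Fin n → α) : Prop :=
  (({i | y i ≠ x i} : Set (Fin n)).ncard : ℝ) ≤ γ * n

/-! ### The estimator -/

/-- The `ξ`-truncated mean: sort the samples, ignore the `⌊ξ n⌋` smallest and the `⌊ξ n⌋`
largest ones, and return the empirical average of the remaining samples. -/
noncomputable def truncatedMean {n : ℕ} (ξ : ℝ) (x : Fin n → ℝ) : ℝ :=
  let k : ℕ := ⌊ξ * n⌋₊
  let kept : Finset (Fin n) := {i | k ≤ (i : ℕ) ∧ (i : ℕ) + k < n}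
  (∑ i ∈ kept, x (Tuple.sort x i)) / (kept.card : ℝ)

/-- The robust classical shadow estimate of the expectation value of the observable `O` from
`n` (possibly corrupted) records `y`: the `2γ`-truncated mean of the numbers `Tr[O ρ̂ᵢ]`, where
`ρ̂ᵢ` is the classical shadow of the `i`-th record. -/
noncomputable def robustShadowEstimate {d n : ℕ} (γ : ℝ) (O : Matrix (Fin d) (Fin d) ℂ)
    (y : Fin n → ShadowRecord d) : ℝ :=
  truncatedMean (2 * γ) fun i => (O * classicalShadow (y i)).trace.re

/-! ### The Haar measure on the unitary group -/

/-! The single-copy statistic `Z = (d + 1)⟨v|O|v⟩ - Tr O` has mean `Tr[Oρ]` and sub-exponential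
tails at scale `K = hsNorm O`, free of the dimension. A truncated mean of such variables survives a
`γ`-fraction of corruptions with error of order `γ log(1/γ) K`.

Tails: integrating `exp(⟨x|A|x⟩ - |x|²)` over `ℂ^d`, once by diagonalising `A` and once by averaging
over unitaries, gives `E (1 - ⟨v|A|v⟩)^(-d) = ∏ (1 - lᵢ)⁻¹` for Haar-random `v`
(`lintegral_haarUnitary_inv_det`). Hence `d⟨v|A|v⟩ - Tr A` has exponential moment at most
`exp(hsNorm A ^ 2)` (`lintegral_haarUnitary_exp_le`). The Born weight is separated from the
exponential by the arithmetic-geometric mean inequality and the Haar second moment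
(`lintegral_recordLaw_exp_le`), which also gives unbiasedness.

Robustness: for `T` of order `K log(1/γ)`, few honest samples leave `[μ - T, μ + T]`, so after
trimming `2γ` on each side all survivors lie inside. On survivors clipping is invisible, and
corruption and trimming move the clipped sum by `O(γ n T)` (`abs_truncatedMean_sub_le`). Hoeffding's
inequality controls outlier count and clipped mean. The exceptional event depends on the honest
records only, so it serves every adversary at once; a union bound over the observables finishes. -/

instance unitaryGroupSecondCountable (d : ℕ) :
    SecondCountableTopology (Matrix.unitaryGroup (Fin d) ℂ) := by
  have : SecondCountableTopology (Matrix (Fin d) (Fin d) ℂ) :=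
    inferInstanceAs (SecondCountableTopology (Fin d → Fin d → ℂ))
  exact TopologicalSpace.Subtype.secondCountableTopology _

instance haarUnitary_isProbabilityMeasure (d : ℕ) : IsProbabilityMeasure (haarUnitary d) :=
  ⟨Measure.haarMeasure_self⟩

instance haarUnitary_isMulLeftInvariant (d : ℕ) : (haarUnitary d).IsMulLeftInvariant := by
  unfold haarUnitary; infer_instance

/-- A right translate of Haar measure is again a left-invariant probability measure, so uniqueness
applies. -/
instance haarUnitary_isMulRightInvariant (d : ℕ) : (haarUnitary d).IsMulRightInvariant := by
  refine ⟨fun g => ?_⟩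
  have hprob : IsProbabilityMeasure ((haarUnitary d).map (· * g)) :=
    Measure.isProbabilityMeasure_map (measurable_mul_const g).aemeasurable
  have h := Measure.haarMeasure_unique ((haarUnitary d).map (· * g)) ⊤
  rw [TopologicalSpace.PositiveCompacts.coe_top, measure_univ, one_smul] at h
  exact h

theorem integrable_haarUnitary {d : ℕ} {f : Matrix.unitaryGroup (Fin d) ℂ → ℝ}
    (hf : Continuous f) : Integrable f (haarUnitary d) :=
  hf.integrable_of_hasCompactSupport (HasCompactSupport.of_compactSpace f)

/-! ### Spectral decomposition of observables -/

theorem Matrix.IsHermitian.exists_unitary_diagonal {d : ℕ} {A : Matrix (Fin d) (Fin d) ℂ}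
    (hA : A.IsHermitian) :
    ∃ (W : Matrix.unitaryGroup (Fin d) ℂ) (l : Fin d → ℝ),
      A = (W : Matrix (Fin d) (Fin d) ℂ) * Matrix.diagonal (fun i => (l i : ℂ)) *
        (W : Matrix (Fin d) (Fin d) ℂ).conjTranspose := by
  refine ⟨hA.eigenvectorUnitary, hA.eigenvalues, ?_⟩
  conv_lhs => rw [hA.spectral_theorem, Unitary.conjStarAlgAut_apply]
  rfl

theorem conjTranspose_mul_self_unitary {d : ℕ} (W : Matrix.unitaryGroup (Fin d) ℂ) :
    (W : Matrix (Fin d) (Fin d) ℂ).conjTranspose * (W : Matrix (Fin d) (Fin d) ℂ) = 1 :=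
  Matrix.mem_unitaryGroup_iff'.mp W.2

theorem self_mul_conjTranspose_unitary {d : ℕ} (W : Matrix.unitaryGroup (Fin d) ℂ) :
    (W : Matrix (Fin d) (Fin d) ℂ) * (W : Matrix (Fin d) (Fin d) ℂ).conjTranspose = 1 :=
  Matrix.mem_unitaryGroup_iff.mp W.2

theorem trace_conj_unitary {d : ℕ} (W : Matrix.unitaryGroup (Fin d) ℂ)
    (D : Matrix (Fin d) (Fin d) ℂ) :
    ((W : Matrix (Fin d) (Fin d) ℂ) * D * (W : Matrix (Fin d) (Fin d) ℂ).conjTranspose).trace =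
      D.trace := by
  rw [Matrix.trace_mul_comm, ← mul_assoc, conjTranspose_mul_self_unitary, one_mul]

theorem mul_diagonal_mul_conjTranspose_apply {d : ℕ} (V : Matrix (Fin d) (Fin d) ℂ)
    (l : Fin d → ℝ) (b : Fin d) :
    (V * Matrix.diagonal (fun i => (l i : ℂ)) * V.conjTranspose) b b =
      ((∑ i, l i * ‖V b i‖ ^ 2 : ℝ) : ℂ) := by
  rw [Matrix.mul_apply]
  push_cast
  refine Finset.sum_congr rfl fun i _ => ?_
  rw [Matrix.mul_diagonal, Matrix.conjTranspose_apply, ← Complex.mul_conj']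
  simp only [RCLike.star_def]
  ring

theorem bornProb_conj_diagonal {d : ℕ} (W U : Matrix.unitaryGroup (Fin d) ℂ)
    (l : Fin d → ℝ) (b : Fin d) :
    bornProb ((W : Matrix (Fin d) (Fin d) ℂ) * Matrix.diagonal (fun i => (l i : ℂ)) *
        (W : Matrix (Fin d) (Fin d) ℂ).conjTranspose) (U, b) =
      ∑ i, l i * ‖((U * W : Matrix.unitaryGroup (Fin d) ℂ) : Matrix (Fin d) (Fin d) ℂ) b i‖ ^ 2 := by
  have h : (U : Matrix (Fin d) (Fin d) ℂ) *
      ((W : Matrix (Fin d) (Fin d) ℂ) * Matrix.diagonal (fun i => (l i : ℂ)) *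
        (W : Matrix (Fin d) (Fin d) ℂ).conjTranspose) *
      (U : Matrix (Fin d) (Fin d) ℂ).conjTranspose =
      ((U * W : Matrix.unitaryGroup (Fin d) ℂ) : Matrix (Fin d) (Fin d) ℂ) *
        Matrix.diagonal (fun i => (l i : ℂ)) *
      ((U * W : Matrix.unitaryGroup (Fin d) ℂ) : Matrix (Fin d) (Fin d) ℂ).conjTranspose := by
    rw [Submonoid.coe_mul, Matrix.conjTranspose_mul]
    simp only [mul_assoc]
  simp only [bornProb]
  rw [h, mul_diagonal_mul_conjTranspose_apply, Complex.ofReal_re]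

theorem sum_norm_sq_row_unitary {d : ℕ} (U : Matrix.unitaryGroup (Fin d) ℂ) (b : Fin d) :
    ∑ i, ‖(U : Matrix (Fin d) (Fin d) ℂ) b i‖ ^ 2 = 1 := by
  have h := mul_diagonal_mul_conjTranspose_apply (U : Matrix (Fin d) (Fin d) ℂ) (fun _ => 1) b
  simp only [Complex.ofReal_one, Matrix.diagonal_one, mul_one, one_mul,
    self_mul_conjTranspose_unitary, Matrix.one_apply_eq] at h
  exact_mod_cast h.symm

theorem sum_norm_sq_col_unitary {d : ℕ} (U : Matrix.unitaryGroup (Fin d) ℂ) (b : Fin d) :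
    ∑ i, ‖(U : Matrix (Fin d) (Fin d) ℂ) i b‖ ^ 2 = 1 := by
  have h := sum_norm_sq_row_unitary (star U) b
  simpa [Matrix.star_apply] using h

/-- The unitary group acts transitively on the unit sphere. -/
theorem exists_unitary_col_eq {d : ℕ} (b : Fin d) {w : Fin d → ℂ} (hw : ∑ i, ‖w i‖ ^ 2 = 1) :
    ∃ W : Matrix.unitaryGroup (Fin d) ℂ, ∀ i, (W : Matrix (Fin d) (Fin d) ℂ) i b = w i := by
  have hn : ‖(WithLp.toLp 2 w : EuclideanSpace ℂ (Fin d))‖ = 1 := by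
    rw [EuclideanSpace.norm_eq]
    simp [hw]
  have ho : Orthonormal ℂ (({b} : Set (Fin d)).domRestrict
      fun _ : Fin d => (WithLp.toLp 2 w : EuclideanSpace ℂ (Fin d))) := by
    refine ⟨fun i => hn, fun i j hij => (hij (Subsingleton.elim _ _)).elim⟩
  obtain ⟨B, hB⟩ := ho.exists_orthonormalBasis_extension_of_card_eq (by simp)
  refine ⟨⟨_, (EuclideanSpace.basisFun (Fin d) ℂ).toMatrix_orthonormalBasis_mem_unitary B⟩,
    fun i => ?_⟩
  have := hB b rfl
  simp [Module.Basis.toMatrix_apply, this]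

theorem hsNorm_sq_eq_trace {d : ℕ} (A : Matrix (Fin d) (Fin d) ℂ) :
    hsNorm A ^ 2 = (A.conjTranspose * A).trace.re :=
  Real.sq_sqrt (Complex.le_def.mp (Matrix.posSemidef_conjTranspose_mul_self A).trace_nonneg).1

theorem hsNorm_sq {d : ℕ} (A : Matrix (Fin d) (Fin d) ℂ) :
    hsNorm A ^ 2 = ∑ i, ∑ j, ‖A i j‖ ^ 2 := by
  rw [hsNorm_sq_eq_trace, Finset.sum_comm]
  simp only [Matrix.trace, Matrix.diag, Matrix.mul_apply, Matrix.conjTranspose_apply,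
    RCLike.star_def, Complex.conj_mul', Complex.re_sum]
  norm_cast

theorem hsNorm_nonneg {d : ℕ} (A : Matrix (Fin d) (Fin d) ℂ) : 0 ≤ hsNorm A := Real.sqrt_nonneg _

theorem eq_zero_of_hsNorm_eq_zero {d : ℕ} {A : Matrix (Fin d) (Fin d) ℂ} (h : hsNorm A = 0) :
    A = 0 := by
  have h2 := hsNorm_sq A
  rw [h, eq_comm, zero_pow two_ne_zero,
    Finset.sum_eq_zero_iff_of_nonneg fun i _ => by positivity] at h2
  ext i j
  have h3 := h2 i (Finset.mem_univ i)
  rw [Finset.sum_eq_zero_iff_of_nonneg fun i _ => by positivity] at h3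
  simpa using h3 j (Finset.mem_univ j)

theorem hsNorm_sq_conj_diagonal {d : ℕ} (W : Matrix.unitaryGroup (Fin d) ℂ) (l : Fin d → ℝ) :
    hsNorm ((W : Matrix (Fin d) (Fin d) ℂ) * Matrix.diagonal (fun i => (l i : ℂ)) *
        (W : Matrix (Fin d) (Fin d) ℂ).conjTranspose) ^ 2 = ∑ i, l i ^ 2 := by
  set D : Matrix (Fin d) (Fin d) ℂ := Matrix.diagonal (fun i => (l i : ℂ)) with hD
  have hDD : D.conjTranspose * D = Matrix.diagonal (fun i => ((l i ^ 2 : ℝ) : ℂ)) := by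
    rw [hD, Matrix.diagonal_conjTranspose, Matrix.diagonal_mul_diagonal]
    congr 1
    ext i
    simp [sq]
  have h : (((W : Matrix (Fin d) (Fin d) ℂ) * D *
      (W : Matrix (Fin d) (Fin d) ℂ).conjTranspose).conjTranspose *
      ((W : Matrix (Fin d) (Fin d) ℂ) * D * (W : Matrix (Fin d) (Fin d) ℂ).conjTranspose)).trace =
      ((∑ i, l i ^ 2 : ℝ) : ℂ) := by
    rw [Matrix.conjTranspose_mul, Matrix.conjTranspose_mul, Matrix.conjTranspose_conjTranspose]
    have : (W : Matrix (Fin d) (Fin d) ℂ) *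
        (D.conjTranspose * (W : Matrix (Fin d) (Fin d) ℂ).conjTranspose) *
        ((W : Matrix (Fin d) (Fin d) ℂ) * D * (W : Matrix (Fin d) (Fin d) ℂ).conjTranspose) =
        (W : Matrix (Fin d) (Fin d) ℂ) * (D.conjTranspose * D) *
          (W : Matrix (Fin d) (Fin d) ℂ).conjTranspose := by
      calc _ = (W : Matrix (Fin d) (Fin d) ℂ) * (D.conjTranspose *
            ((W : Matrix (Fin d) (Fin d) ℂ).conjTranspose * (W : Matrix (Fin d) (Fin d) ℂ)) * D) *
            (W : Matrix (Fin d) (Fin d) ℂ).conjTranspose := by simp only [mul_assoc]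
        _ = _ := by rw [conjTranspose_mul_self_unitary, mul_one]
    rw [this, trace_conj_unitary, hDD, Matrix.trace_diagonal]
    push_cast
    rfl
  rw [hsNorm_sq_eq_trace, h, Complex.ofReal_re]

/-- The expectation of an observable in any pure state is at most its Hilbert-Schmidt norm. -/
theorem abs_bornProb_le_hsNorm {d : ℕ} {A : Matrix (Fin d) (Fin d) ℂ} (hA : A.IsHermitian)
    (x : ShadowRecord d) : |bornProb A x| ≤ hsNorm A := by
  obtain ⟨W, l, rfl⟩ := hA.exists_unitary_diagonal
  obtain ⟨U, b⟩ := x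
  rw [bornProb_conj_diagonal]
  have hl : ∀ i, |l i| ≤ hsNorm ((W : Matrix (Fin d) (Fin d) ℂ) *
      Matrix.diagonal (fun i => (l i : ℂ)) * (W : Matrix (Fin d) (Fin d) ℂ).conjTranspose) := by
    intro i
    refine abs_le_of_sq_le_sq ?_ (hsNorm_nonneg _)
    rw [hsNorm_sq_conj_diagonal]
    exact Finset.single_le_sum (f := fun i => l i ^ 2) (fun i _ => sq_nonneg _) (Finset.mem_univ i)
  refine (Finset.abs_sum_le_sum_abs _ _).trans ?_
  calc _ ≤ ∑ i, hsNorm ((W : Matrix (Fin d) (Fin d) ℂ) *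
      Matrix.diagonal (fun i => (l i : ℂ)) * (W : Matrix (Fin d) (Fin d) ℂ).conjTranspose) *
        ‖((U * W : Matrix.unitaryGroup (Fin d) ℂ) : Matrix (Fin d) (Fin d) ℂ) b i‖ ^ 2 := by
        gcongr with i
        rw [abs_mul, abs_of_nonneg (sq_nonneg ‖_‖)]
        gcongr
        exact hl i
    _ = _ := by rw [← Finset.mul_sum, sum_norm_sq_row_unitary, mul_one]

theorem continuous_bornProb {d : ℕ} (A : Matrix (Fin d) (Fin d) ℂ) : Continuous (bornProb A) := by
  refine continuous_prod_of_discrete_right.mpr fun b => ?_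
  simp only [bornProb]
  fun_prop

/-- Since `⟨v|O|v⟩` is the diagonal entry of `U O U†` at `b`, the estimator is an affine function of
`bornProb O`, and Haar moments of quadratic forms suffice. -/
theorem trace_mul_classicalShadow {d : ℕ} (O : Matrix (Fin d) (Fin d) ℂ) (x : ShadowRecord d) :
    (O * classicalShadow x).trace.re = ((d : ℝ) + 1) * bornProb O x - O.trace.re := by
  have h : (O * Matrix.vecMulVec (outcomeVector x) (star (outcomeVector x))).trace =
      ((x.1 : Matrix (Fin d) (Fin d) ℂ) * O *
        (x.1 : Matrix (Fin d) (Fin d) ℂ).conjTranspose) x.2 x.2 := by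
    rw [Matrix.mul_vecMulVec, Matrix.trace_vecMulVec, outcomeVector, Matrix.star_mulVec,
      Matrix.mulVec_mulVec, dotProduct_comm, ← Matrix.dotProduct_mulVec,
      Matrix.mulVec_mulVec, Matrix.conjTranspose_conjTranspose]
    simp [Matrix.mul_assoc]
  rw [classicalShadow, mul_sub, mul_one, Matrix.trace_sub, Matrix.mul_smul, Matrix.trace_smul, h,
    bornProb, Complex.sub_re]
  simp [Complex.mul_re]

/-! ### Gaussian integrals and exponential moments of Haar-random quadratic forms -/

theorem integral_exp_neg_mul_norm_sq_complex {c : ℝ} (hc : 0 < c) :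
    ∫ z : ℂ, Real.exp (-c * ‖z‖ ^ 2) = Real.pi / c := by
  rw [GaussianFourier.integral_rexp_neg_mul_sq_norm hc]
  simp [Complex.finrank_real_complex]

theorem lintegral_exp_neg_sum_norm_sq {d : ℕ} {c : Fin d → ℝ} (hc : ∀ i, 0 < c i) :
    ∫⁻ x : Fin d → ℂ, ENNReal.ofReal (Real.exp (-∑ i, c i * ‖x i‖ ^ 2)) =
      ENNReal.ofReal (∏ i, Real.pi / c i) := by
  -- A non-integrable function has Bochner integral `0` by convention, so the positive value `π / c`
  -- forces integrability.
  have hint : ∀ i, Integrable (fun z : ℂ => Real.exp (-c i * ‖z‖ ^ 2)) := fun i => by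
    by_contra h
    have h0 := integral_undef h
    rw [integral_exp_neg_mul_norm_sq_complex (hc i)] at h0
    have : 0 < Real.pi / c i := div_pos Real.pi_pos (hc i)
    exact this.ne' h0
  have heq : ∀ x : Fin d → ℂ, Real.exp (-∑ i, c i * ‖x i‖ ^ 2) =
      ∏ i, Real.exp (-c i * ‖x i‖ ^ 2) := fun x => by
    rw [← Real.exp_sum, ← Finset.sum_neg_distrib]
    simp only [neg_mul]
  simp only [heq]
  have hprod : Integrable (fun x : Fin d → ℂ => ∏ i, Real.exp (-c i * ‖x i‖ ^ 2)) :=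
    Integrable.fintype_prod (f := fun i z => Real.exp (-c i * ‖z‖ ^ 2)) hint
  rw [← ofReal_integral_eq_lintegral_ofReal hprod
    (Filter.Eventually.of_forall fun x => by positivity)]
  congr 1
  rw [volume_pi, integral_fintype_prod_eq_prod (fun i (z : ℂ) => Real.exp (-c i * ‖z‖ ^ 2))]
  exact Finset.prod_congr rfl fun i _ => integral_exp_neg_mul_norm_sq_complex (hc i)

theorem sum_norm_sq_unitary_mulVec {d : ℕ} (U : Matrix.unitaryGroup (Fin d) ℂ) (x : Fin d → ℂ) :
    ∑ i, ‖((U : Matrix (Fin d) (Fin d) ℂ).mulVec x) i‖ ^ 2 = ∑ i, ‖x i‖ ^ 2 := by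
  have h : ∀ y : Fin d → ℂ, ((∑ i, ‖y i‖ ^ 2 : ℝ) : ℂ) = star y ⬝ᵥ y := fun y => by
    simp [dotProduct, Complex.conj_mul']
  have : ((∑ i, ‖((U : Matrix (Fin d) (Fin d) ℂ).mulVec x) i‖ ^ 2 : ℝ) : ℂ) =
      ((∑ i, ‖x i‖ ^ 2 : ℝ) : ℂ) := by
    rw [h, h, Matrix.star_mulVec, ← Matrix.dotProduct_mulVec, Matrix.mulVec_mulVec,
      conjTranspose_mul_self_unitary, Matrix.one_mulVec]
  exact_mod_cast this

/-- An invertible linear map scales Lebesgue measure by a constant. Testing on the unitarily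
invariant `exp(-|x|²)`, whose integral is finite and positive, shows that the constant is 1, without
computing a real determinant. -/
theorem measurePreserving_unitary_mulVec {d : ℕ} (U : Matrix.unitaryGroup (Fin d) ℂ) :
    MeasurePreserving (fun x : Fin d → ℂ => (U : Matrix (Fin d) (Fin d) ℂ).mulVec x) := by
  set f : (Fin d → ℂ) →ₗ[ℝ] (Fin d → ℂ) :=
    (Matrix.mulVecLin (U : Matrix (Fin d) (Fin d) ℂ)).restrictScalars ℝ with hf
  set g : (Fin d → ℂ) →ₗ[ℝ] (Fin d → ℂ) :=
    (Matrix.mulVecLin (U : Matrix (Fin d) (Fin d) ℂ).conjTranspose).restrictScalars ℝ with hg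
  have hfg : f ∘ₗ g = LinearMap.id := by
    refine LinearMap.ext fun x => ?_
    simp [hf, hg, Matrix.mulVec_mulVec, self_mul_conjTranspose_unitary]
  have hdet : LinearMap.det f ≠ 0 := by
    intro h
    have := congrArg LinearMap.det hfg
    rw [LinearMap.det_comp, h, zero_mul, LinearMap.det_id] at this
    exact zero_ne_one this
  have hcont : Continuous (fun x : Fin d → ℂ => (U : Matrix (Fin d) (Fin d) ℂ).mulVec x) := by
    fun_prop
  have hmap := Measure.map_linearMap_addHaar_eq_smul_addHaar (volume : Measure (Fin d → ℂ)) hdet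
  have hfc : (f : (Fin d → ℂ) → (Fin d → ℂ)) =
    fun x => (U : Matrix (Fin d) (Fin d) ℂ).mulVec x := rfl
  rw [hfc] at hmap
  refine ⟨hcont.measurable, ?_⟩
  have hI := lintegral_exp_neg_sum_norm_sq (d := d) (c := fun _ => 1) (fun _ => one_pos)
  have hm : Measurable fun x : Fin d → ℂ =>
      ENNReal.ofReal (Real.exp (-∑ i, 1 * ‖x i‖ ^ 2)) := by fun_prop
  have h1 := lintegral_map (μ := volume) hm hcont.measurable
  rw [hmap, lintegral_smul_measure] at h1
  simp only [one_mul, sum_norm_sq_unitary_mulVec] at h1 hI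
  rw [hI] at h1
  have hpos : ENNReal.ofReal (∏ _i : Fin d, Real.pi / 1) ≠ 0 := by
    rw [ne_eq, ENNReal.ofReal_eq_zero, not_le]
    positivity
  have hc : ENNReal.ofReal |(LinearMap.det f)⁻¹| = 1 := by
    have h2 : ENNReal.ofReal |(LinearMap.det f)⁻¹| * ENNReal.ofReal (∏ _i : Fin d, Real.pi / 1) =
      1 * ENNReal.ofReal (∏ _i : Fin d, Real.pi / 1) := by rw [one_mul]; exact h1
    exact (ENNReal.mul_left_inj hpos ENNReal.ofReal_ne_top).mp h2
  rw [hmap, hc, one_smul]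

/-- The quadratic form `x ↦ ⟨x|A|x⟩` of a matrix. -/
noncomputable def quadForm {d : ℕ} (A : Matrix (Fin d) (Fin d) ℂ) (x : Fin d → ℂ) : ℝ :=
  (star x ⬝ᵥ A.mulVec x).re

/-- The outcome vector is `U†|b⟩`, so column `b` of `W` is the outcome vector of the record `(W⁻¹,
b)`; hence the inverse. -/
theorem quadForm_unitary_col {d : ℕ} (A : Matrix (Fin d) (Fin d) ℂ)
    (W : Matrix.unitaryGroup (Fin d) ℂ) (b : Fin d) (r : ℝ) {x : Fin d → ℂ}
    (hx : ∀ i, x i = r * (W : Matrix (Fin d) (Fin d) ℂ) i b) :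
    quadForm A x = r ^ 2 * bornProb A (W⁻¹, b) := by
  have h1 : x = (r : ℂ) • (W : Matrix (Fin d) (Fin d) ℂ).mulVec (Pi.single b 1) := by
    ext i
    simp [hx]
  have h2 : ((W⁻¹ : Matrix.unitaryGroup (Fin d) ℂ) : Matrix (Fin d) (Fin d) ℂ) =
      (W : Matrix (Fin d) (Fin d) ℂ).conjTranspose := rfl
  have h3 : star x ⬝ᵥ A.mulVec x = ((r ^ 2 : ℝ) : ℂ) *
      ((W : Matrix (Fin d) (Fin d) ℂ).conjTranspose * A * (W : Matrix (Fin d) (Fin d) ℂ)) b b := by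
    rw [h1, star_smul, Matrix.mulVec_smul, dotProduct_smul, smul_dotProduct, Matrix.star_mulVec,
      ← Matrix.dotProduct_mulVec, Matrix.mulVec_mulVec, Matrix.mulVec_mulVec]
    simp [← mul_assoc, sq]
  rw [quadForm, h3, Complex.re_ofReal_mul, bornProb, h2, Matrix.conjTranspose_conjTranspose]

theorem quadForm_mulVec_conj_diagonal {d : ℕ} (W : Matrix.unitaryGroup (Fin d) ℂ)
    (l : Fin d → ℝ) (x : Fin d → ℂ) :
    quadForm ((W : Matrix (Fin d) (Fin d) ℂ) * Matrix.diagonal (fun i => (l i : ℂ)) *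
        (W : Matrix (Fin d) (Fin d) ℂ).conjTranspose)
        ((W : Matrix (Fin d) (Fin d) ℂ).mulVec x) = ∑ i, l i * ‖x i‖ ^ 2 := by
  rw [quadForm, Matrix.star_mulVec, Matrix.mulVec_mulVec, ← Matrix.dotProduct_mulVec,
    Matrix.mulVec_mulVec, mul_assoc, conjTranspose_mul_self_unitary, mul_one, ← mul_assoc,
    conjTranspose_mul_self_unitary, one_mul]
  have : star x ⬝ᵥ (Matrix.diagonal fun i => (l i : ℂ)).mulVec x =
      ((∑ i, l i * ‖x i‖ ^ 2 : ℝ) : ℂ) := by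
    push_cast
    refine Finset.sum_congr rfl fun i _ => ?_
    rw [Matrix.mulVec_diagonal, ← Complex.conj_mul']
    simp only [Pi.star_apply, RCLike.star_def]
    ring
  rw [this, Complex.ofReal_re]

theorem continuous_quadForm {d : ℕ} (A : Matrix (Fin d) (Fin d) ℂ) : Continuous (quadForm A) := by
  unfold quadForm dotProduct
  fun_prop

/-- Averaging a Gaussian quadratic exponential over the unitary group. -/
theorem lintegral_haarUnitary_inv_det {d : ℕ} (b : Fin d) (W : Matrix.unitaryGroup (Fin d) ℂ)
    {l : Fin d → ℝ} (hl : ∀ i, l i < 1)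
    (hq : ∀ x : ShadowRecord d, bornProb ((W : Matrix (Fin d) (Fin d) ℂ) *
      Matrix.diagonal (fun i => (l i : ℂ)) * (W : Matrix (Fin d) (Fin d) ℂ).conjTranspose) x < 1) :
    ∫⁻ U, ENNReal.ofReal ((1 - bornProb ((W : Matrix (Fin d) (Fin d) ℂ) *
      Matrix.diagonal (fun i => (l i : ℂ)) * (W : Matrix (Fin d) (Fin d) ℂ).conjTranspose)
        (U, b))⁻¹ ^ d) ∂haarUnitary d = ENNReal.ofReal (∏ i, (1 - l i)⁻¹) := by
  set A := (W : Matrix (Fin d) (Fin d) ℂ) * Matrix.diagonal (fun i => (l i : ℂ)) *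
    (W : Matrix (Fin d) (Fin d) ℂ).conjTranspose with hA
  set e : (Fin d → ℂ) → ℝ := fun x => ∑ i, ‖x i‖ ^ 2 with he
  -- The double integral of `G (U⁻¹ x)` over `x` and `U` is evaluated in both orders.
  set G : (Fin d → ℂ) → ENNReal := fun x => ENNReal.ofReal (Real.exp (quadForm A x - e x)) with hG
  have hGm : Measurable G := by
    have := (continuous_quadForm A).measurable
    fun_prop
  have hee : ∀ (U : Matrix.unitaryGroup (Fin d) ℂ) x,
      e ((U : Matrix (Fin d) (Fin d) ℂ).mulVec x) = e x := sum_norm_sq_unitary_mulVec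
  have hinv : ∀ U : Matrix.unitaryGroup (Fin d) ℂ,
      ∫⁻ x, G ((U : Matrix (Fin d) (Fin d) ℂ).mulVec x) = ∫⁻ x, G x := fun U =>
    (measurePreserving_unitary_mulVec U).lintegral_comp hGm
  have hgauss : ∫⁻ x, G x = ENNReal.ofReal (∏ i, Real.pi / (1 - l i)) := by
    rw [← hinv W, ← lintegral_exp_neg_sum_norm_sq fun i => sub_pos.mpr (hl i)]
    refine lintegral_congr fun x => ?_
    simp only [hG, hee]
    rw [hA, quadForm_mulVec_conj_diagonal]
    simp only [he, sub_mul, one_mul, Finset.sum_sub_distrib, neg_sub]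
  have hswap : ∫⁻ U, (∫⁻ x, G (((U⁻¹ : Matrix.unitaryGroup (Fin d) ℂ) :
      Matrix (Fin d) (Fin d) ℂ).mulVec x)) ∂haarUnitary d =
      ∫⁻ x, ∫⁻ U, G (((U⁻¹ : Matrix.unitaryGroup (Fin d) ℂ) :
      Matrix (Fin d) (Fin d) ℂ).mulVec x) ∂haarUnitary d := by
    refine lintegral_lintegral_swap (Measurable.aemeasurable ?_)
    refine hGm.comp (Continuous.measurable ?_)
    exact Continuous.matrix_mulVec (continuous_subtype_val.comp (continuous_inv.comp continuous_fst))
      continuous_snd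
  have hleft : ∫⁻ U, (∫⁻ x, G (((U⁻¹ : Matrix.unitaryGroup (Fin d) ℂ) :
      Matrix (Fin d) (Fin d) ℂ).mulVec x)) ∂haarUnitary d =
      ENNReal.ofReal (∏ i, Real.pi / (1 - l i)) := by
    simp only [hinv, hgauss, lintegral_const, measure_univ, mul_one]
  -- Each `x` is `√(e x)` times column `b` of some unitary `V`, and left invariance absorbs `V`; the
  -- average depends on `x` only through `e x`.
  have horbit : ∀ x : Fin d → ℂ, ∫⁻ U, G (((U⁻¹ : Matrix.unitaryGroup (Fin d) ℂ) :
      Matrix (Fin d) (Fin d) ℂ).mulVec x) ∂haarUnitary d =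
      ∫⁻ U, ENNReal.ofReal (Real.exp (-((1 - bornProb A (U, b)) * e x))) ∂haarUnitary d := by
    intro x
    have he0 : 0 ≤ e x := Finset.sum_nonneg fun i _ => by positivity
    obtain ⟨V, hV⟩ : ∃ V : Matrix.unitaryGroup (Fin d) ℂ,
        ∀ i, x i = (Real.sqrt (e x) : ℝ) * (V : Matrix (Fin d) (Fin d) ℂ) i b := by
      rcases he0.eq_or_lt with h | h
      · refine ⟨1, fun i => ?_⟩
        rw [← h, Real.sqrt_zero, Complex.ofReal_zero, zero_mul]
        have := (Finset.sum_eq_zero_iff_of_nonneg fun i _ => by positivity).mp h.symm i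
          (Finset.mem_univ i)
        simpa using this
      · have hs : 0 < Real.sqrt (e x) := Real.sqrt_pos.mpr h
        obtain ⟨V, hV⟩ := exists_unitary_col_eq b (w := fun i => x i / (Real.sqrt (e x) : ℝ)) (by
          simp only [norm_div, div_pow, Complex.norm_real, Real.norm_eq_abs, sq_abs,
            Real.sq_sqrt he0, ← Finset.sum_div]
          exact div_self h.ne')
        refine ⟨V, fun i => ?_⟩
        rw [hV, mul_div_cancel₀]
        exact_mod_cast hs.ne'
    rw [← lintegral_mul_left_eq_self (μ := haarUnitary d)
      (fun U => ENNReal.ofReal (Real.exp (-((1 - bornProb A (U, b)) * e x)))) V⁻¹]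
    refine lintegral_congr fun U => ?_
    simp only [hG]
    rw [hee, quadForm_unitary_col A (U⁻¹ * V) b (Real.sqrt (e x)), Real.sq_sqrt he0, mul_inv_rev,
      inv_inv]
    · congr 2
      ring
    · intro i
      have : x = fun j => (Real.sqrt (e x) : ℂ) * (V : Matrix (Fin d) (Fin d) ℂ) j b := funext hV
      conv_lhs => rw [this]
      simp only [Matrix.mulVec, dotProduct, Submonoid.coe_mul, Matrix.mul_apply, Finset.mul_sum]
      exact Finset.sum_congr rfl fun j _ => by ring
  have hright : ∫⁻ x, ∫⁻ U, G (((U⁻¹ : Matrix.unitaryGroup (Fin d) ℂ) :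
      Matrix (Fin d) (Fin d) ℂ).mulVec x) ∂haarUnitary d =
      ∫⁻ U, ENNReal.ofReal (Real.pi ^ d * (1 - bornProb A (U, b))⁻¹ ^ d) ∂haarUnitary d := by
    simp only [horbit]
    have hbm : Measurable fun U : Matrix.unitaryGroup (Fin d) ℂ => bornProb A (U, b) :=
      ((continuous_bornProb A).comp (Continuous.prodMk_left b)).measurable
    have hem : Measurable e := by fun_prop
    have hm : Measurable (Function.uncurry fun (x : Fin d → ℂ) (U : Matrix.unitaryGroup (Fin d) ℂ) =>
        ENNReal.ofReal (Real.exp (-((1 - bornProb A (U, b)) * e x)))) :=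
      ENNReal.measurable_ofReal.comp (Real.measurable_exp.comp
        ((measurable_const.sub (hbm.comp measurable_snd)).mul (hem.comp measurable_fst)).neg)
    -- With `U` fixed the Gaussian is isotropic with parameter `1 - bornProb A (U, b) > 0`.
    rw [lintegral_lintegral_swap hm.aemeasurable]
    refine lintegral_congr fun U => ?_
    have := lintegral_exp_neg_sum_norm_sq (d := d) (c := fun _ => 1 - bornProb A (U, b))
      (fun _ => sub_pos.mpr (hq _))
    rw [Finset.prod_const, Finset.card_univ, Fintype.card_fin, div_eq_mul_inv, mul_pow] at this
    rw [← this]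
    simp only [he, Finset.mul_sum]
  rw [hswap, hright] at hleft
  have hpi : 0 < Real.pi ^ d := pow_pos Real.pi_pos d
  simp only [ENNReal.ofReal_mul hpi.le, div_eq_mul_inv, Finset.prod_mul_distrib, Finset.prod_const,
    Finset.card_univ, Fintype.card_fin] at hleft
  rw [lintegral_const_mul' _ _ ENNReal.ofReal_ne_top] at hleft
  exact (ENNReal.mul_right_inj (by simpa using hpi) ENNReal.ofReal_ne_top).mp hleft

/-- For `t ≤ 0`, `(1 + t + t²)(1 - t) = 1 - t³ ≥ 1` is enough. For `t ≥ 0` the cubic loss is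
compensated by the quadratic term of the exponential. -/
theorem inv_one_sub_le_exp {t : ℝ} (ht : |t| ≤ 1 / 2) : (1 - t)⁻¹ ≤ Real.exp (t + t ^ 2) := by
  have ⟨h1, h2⟩ := abs_le.mp ht
  have h3 : 0 < 1 - t := by linarith
  have h4 : Real.exp (-(t + t ^ 2)) ≤ 1 - t := by
    rw [Real.exp_neg]
    refine inv_le_of_inv_le₀ h3 ((inv_le_iff_one_le_mul₀ h3).mpr ?_)
    rcases le_total 0 t with h0 | h0
    · have h5 := Real.quadratic_le_exp_of_nonneg (x := t + t ^ 2) (by positivity)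
      have h6 : 0 ≤ t ^ 2 * (1 - (t + t ^ 2 + t ^ 3)) := by
        refine mul_nonneg (sq_nonneg t) ?_
        nlinarith [mul_nonneg h0 h0, pow_le_pow_left₀ h0 h2 2, pow_le_pow_left₀ h0 h2 3]
      nlinarith [mul_le_mul_of_nonneg_right h5 h3.le]
    · have h5 := Real.add_one_le_exp (t + t ^ 2)
      nlinarith [mul_le_mul_of_nonneg_right h5 h3.le, mul_nonneg (neg_nonneg.mpr h0) (sq_nonneg t)]
  rw [Real.exp_neg] at h4
  exact inv_le_of_inv_le₀ (Real.exp_pos _) h4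

theorem exp_le_inv_one_sub {t : ℝ} (ht : t < 1) : Real.exp t ≤ (1 - t)⁻¹ := by
  have h1 : 0 < 1 - t := by linarith
  have h := Real.add_one_le_exp (-t)
  rw [← inv_inv (Real.exp t), ← Real.exp_neg]
  exact inv_anti₀ h1 (by linarith)

/-- Haar-random expectation values of an observable have sub-exponential fluctuations. -/
theorem lintegral_haarUnitary_exp_le {d : ℕ} {A : Matrix (Fin d) (Fin d) ℂ} (hA : A.IsHermitian)
    (hA1 : hsNorm A ≤ 1 / 2) (b : Fin d) :
    ∫⁻ U, ENNReal.ofReal (Real.exp (d * bornProb A (U, b) - A.trace.re)) ∂haarUnitary d ≤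
      ENNReal.ofReal (Real.exp (hsNorm A ^ 2)) := by
  have hq : ∀ x, bornProb A x < 1 := fun x =>
    ((le_abs_self _).trans (abs_bornProb_le_hsNorm hA x)).trans_lt (by linarith)
  obtain ⟨W, l, hAW⟩ := hA.exists_unitary_diagonal
  have hsum : hsNorm A ^ 2 = ∑ i, l i ^ 2 := by rw [hAW, hsNorm_sq_conj_diagonal]
  have hl : ∀ i, |l i| ≤ 1 / 2 := fun i => by
    have h1 : l i ^ 2 ≤ hsNorm A ^ 2 := by
      rw [hsum]
      exact Finset.single_le_sum (f := fun i => l i ^ 2) (fun i _ => sq_nonneg _)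
        (Finset.mem_univ i)
    exact (abs_le_of_sq_le_sq h1 (hsNorm_nonneg A)).trans hA1
  have htr : A.trace.re = ∑ i, l i := by
    rw [hAW, trace_conj_unitary, Matrix.trace_diagonal]
    simp
  have key := lintegral_haarUnitary_inv_det b W
    (fun i => ((le_abs_self _).trans (hl i)).trans_lt (by norm_num)) (by rw [← hAW]; exact hq)
  rw [← hAW] at key
  -- The `d`-th power of `exp q ≤ (1 - q)⁻¹` leads to the determinant formula; the factor `exp(-Tr
  -- A)` then cancels the first-order term, leaving `∑ lᵢ²`.
  calc _ ≤ ∫⁻ U, ENNReal.ofReal ((1 - bornProb A (U, b))⁻¹ ^ d) *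
        ENNReal.ofReal (Real.exp (-A.trace.re)) ∂haarUnitary d := by
        refine lintegral_mono fun U => ?_
        have h1 : 0 < 1 - bornProb A (U, b) := sub_pos.mpr (hq _)
        rw [← ENNReal.ofReal_mul (by positivity), sub_eq_add_neg, Real.exp_add, Real.exp_nat_mul]
        gcongr
        exact exp_le_inv_one_sub (hq _)
    _ = ENNReal.ofReal (∏ i, (1 - l i)⁻¹) * ENNReal.ofReal (Real.exp (-A.trace.re)) := by
        rw [lintegral_mul_const' _ _ ENNReal.ofReal_ne_top, key]
    _ ≤ ENNReal.ofReal (∏ i, Real.exp (l i + l i ^ 2)) *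
        ENNReal.ofReal (Real.exp (-A.trace.re)) := by
        refine mul_le_mul_left (ENNReal.ofReal_le_ofReal (Finset.prod_le_prod (fun i _ => ?_)
          fun i _ => inv_one_sub_le_exp (hl i))) _
        exact inv_nonneg.mpr (by linarith [(abs_le.mp (hl i)).2])
    _ = _ := by
        rw [← ENNReal.ofReal_mul (by positivity), ← Real.exp_sum, ← Real.exp_add,
          Finset.sum_add_distrib, hsum, htr]
        congr 2
        ring

/-! ### Second moments of Haar-random quadratic forms -/

/-- The amplitude `⟨b|U|w⟩`. -/
noncomputable def rowAmplitude {d : ℕ} (b : Fin d) (w : Fin d → ℂ)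
    (U : Matrix.unitaryGroup (Fin d) ℂ) : ℂ :=
  (U : Matrix (Fin d) (Fin d) ℂ).mulVec w b

theorem continuous_rowAmplitude {d : ℕ} (b : Fin d) (w : Fin d → ℂ) :
    Continuous (rowAmplitude b w) := by
  have h : Continuous fun U : Matrix.unitaryGroup (Fin d) ℂ =>
      (U : Matrix (Fin d) (Fin d) ℂ).mulVec w :=
    continuous_subtype_val.matrix_mulVec continuous_const
  exact (continuous_apply b).comp h

theorem rowAmplitude_add_smul {d : ℕ} (b : Fin d) (w z : Fin d → ℂ) (c : ℂ)
    (U : Matrix.unitaryGroup (Fin d) ℂ) :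
    rowAmplitude b (w + c • z) U = rowAmplitude b w U + c * rowAmplitude b z U := by
  simp [rowAmplitude, Matrix.mulVec_add, Matrix.mulVec_smul]

theorem mul_apply_eq_rowAmplitude {d : ℕ} (U W : Matrix.unitaryGroup (Fin d) ℂ) (b i : Fin d) :
    ((U * W : Matrix.unitaryGroup (Fin d) ℂ) : Matrix (Fin d) (Fin d) ℂ) b i =
      rowAmplitude b (fun j => (W : Matrix (Fin d) (Fin d) ℂ) j i) U := rfl

/-- The fourth absolute moment of an entry of a Haar-random unitary. -/
noncomputable def haarFourthMoment {d : ℕ} (b : Fin d) : ℝ :=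
  ∫ U, ‖(U : Matrix (Fin d) (Fin d) ℂ) b b‖ ^ 4 ∂haarUnitary d

/-- Right invariance rotates `w` to a multiple of a basis vector, so only its norm matters. The
constant is found later, by normalisation. -/
theorem integral_norm_rowAmplitude_pow_four {d : ℕ} (b : Fin d) (w : Fin d → ℂ) :
    ∫ U, ‖rowAmplitude b w U‖ ^ 4 ∂haarUnitary d =
      haarFourthMoment b * (∑ i, ‖w i‖ ^ 2) ^ 2 := by
  set N := ∑ i, ‖w i‖ ^ 2 with hN
  have hN0 : 0 ≤ N := Finset.sum_nonneg fun i _ => by positivity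
  rcases hN0.eq_or_lt with h | h
  · have hw : w = 0 := by
      ext i
      have := (Finset.sum_eq_zero_iff_of_nonneg fun i _ => by positivity).mp h.symm i
        (Finset.mem_univ i)
      simpa using this
    rw [← h]
    simp [hw, rowAmplitude]
  · have hs : (Real.sqrt N : ℂ) ≠ 0 := by exact_mod_cast (Real.sqrt_pos.mpr h).ne'
    obtain ⟨V, hV⟩ := exists_unitary_col_eq b (w := fun i => w i / (Real.sqrt N : ℝ)) (by
      simp only [norm_div, div_pow, Complex.norm_real, Real.norm_eq_abs, sq_abs,
        Real.sq_sqrt hN0, ← Finset.sum_div]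
      exact div_self h.ne')
    have hamp : ∀ U : Matrix.unitaryGroup (Fin d) ℂ, rowAmplitude b w U = (Real.sqrt N : ℂ) *
        ((U * V : Matrix.unitaryGroup (Fin d) ℂ) : Matrix (Fin d) (Fin d) ℂ) b b := fun U => by
      rw [mul_apply_eq_rowAmplitude]
      simp only [rowAmplitude, hV, Matrix.mulVec, dotProduct, Finset.mul_sum]
      refine Finset.sum_congr rfl fun i _ => ?_
      field_simp
    have h4 : ‖(Real.sqrt N : ℂ)‖ ^ 4 = N ^ 2 := by
      rw [Complex.norm_real, Real.norm_of_nonneg (Real.sqrt_nonneg N),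
        show Real.sqrt N ^ 4 = (Real.sqrt N ^ 2) ^ 2 by ring, Real.sq_sqrt hN0]
    simp only [hamp, norm_mul, mul_pow, h4]
    rw [integral_const_mul, integral_mul_right_eq_self (μ := haarUnitary d)
      (fun U => ‖(U : Matrix (Fin d) (Fin d) ℂ) b b‖ ^ 4) V, mul_comm, haarFourthMoment]

theorem norm_add_mul_sq (p q c : ℂ) (hc : ‖c‖ = 1) :
    ‖p + c * q‖ ^ 2 = ‖p‖ ^ 2 + ‖q‖ ^ 2 + 2 * (c * (star p * q)).re := by
  rw [Complex.sq_norm, Complex.normSq_add, ← Complex.sq_norm, ← Complex.sq_norm, norm_mul, hc,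
    one_mul, ← Complex.conj_re]
  congr 3
  simp only [map_mul, Complex.conj_conj, RCLike.star_def]
  ring

theorem sum_fourth_roots_sq (s : ℝ) (t : ℂ) :
    (s + 2 * (1 * t).re) ^ 2 + (s + 2 * (-1 * t).re) ^ 2 + (s + 2 * (Complex.I * t).re) ^ 2 +
      (s + 2 * (-Complex.I * t).re) ^ 2 = 4 * s ^ 2 + 8 * ‖t‖ ^ 2 := by
  rw [Complex.sq_norm, Complex.normSq_apply]
  simp
  ring

/-- Polarisation: summing `‖p + c q‖⁴` over the fourth roots of unity `c` isolates `‖p‖²‖q‖²`, and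
the fourth moment is known for each vector `w + c z`. -/
theorem integral_norm_sq_mul_norm_sq_rowAmplitude {d : ℕ} (b : Fin d) (w z : Fin d → ℂ) :
    ∫ U, ‖rowAmplitude b w U‖ ^ 2 * ‖rowAmplitude b z U‖ ^ 2 ∂haarUnitary d =
      haarFourthMoment b / 2 *
        ((∑ i, ‖w i‖ ^ 2) * (∑ i, ‖z i‖ ^ 2) + ‖∑ i, star (w i) * z i‖ ^ 2) := by
  have hpt : ∀ p q : ℂ, ‖p + 1 * q‖ ^ 4 + ‖p + -1 * q‖ ^ 4 + ‖p + Complex.I * q‖ ^ 4 +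
      ‖p + -Complex.I * q‖ ^ 4 = 4 * (‖p‖ ^ 4 + ‖q‖ ^ 4) + 16 * (‖p‖ ^ 2 * ‖q‖ ^ 2) := by
    intro p q
    have h4 : ∀ c : ℂ, ‖c‖ ^ 4 = (‖c‖ ^ 2) ^ 2 := fun c => by ring
    simp only [h4]
    rw [norm_add_mul_sq p q 1 (by simp), norm_add_mul_sq p q (-1) (by simp),
      norm_add_mul_sq p q Complex.I (by simp), norm_add_mul_sq p q (-Complex.I) (by simp),
      sum_fourth_roots_sq, norm_mul, norm_star]
    ring
  have hvec : ∀ c : ℂ, ‖c‖ = 1 → ∑ i, ‖(w + c • z) i‖ ^ 2 =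
      (∑ i, ‖w i‖ ^ 2 + ∑ i, ‖z i‖ ^ 2) + 2 * (c * ∑ i, star (w i) * z i).re := by
    intro c hc
    simp only [Pi.add_apply, Pi.smul_apply, smul_eq_mul, norm_add_mul_sq _ _ c hc,
      Finset.sum_add_distrib, ← Finset.mul_sum, ← Complex.re_sum]
  have hint : ∀ v : Fin d → ℂ, Integrable (fun U => ‖rowAmplitude b v U‖ ^ 4) (haarUnitary d) :=
    fun v => integrable_haarUnitary ((continuous_rowAmplitude b v).norm.pow 4)
  have hint2 : Integrable (fun U => ‖rowAmplitude b w U‖ ^ 2 * ‖rowAmplitude b z U‖ ^ 2)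
      (haarUnitary d) := integrable_haarUnitary
    (((continuous_rowAmplitude b w).norm.pow 2).mul ((continuous_rowAmplitude b z).norm.pow 2))
  have hL : ∫ U, (‖rowAmplitude b (w + (1 : ℂ) • z) U‖ ^ 4 +
      ‖rowAmplitude b (w + (-1 : ℂ) • z) U‖ ^ 4 +
      ‖rowAmplitude b (w + Complex.I • z) U‖ ^ 4 +
      ‖rowAmplitude b (w + (-Complex.I) • z) U‖ ^ 4) ∂haarUnitary d =
      ∫ U, (4 * (‖rowAmplitude b w U‖ ^ 4 + ‖rowAmplitude b z U‖ ^ 4) +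
        16 * (‖rowAmplitude b w U‖ ^ 2 * ‖rowAmplitude b z U‖ ^ 2)) ∂haarUnitary d := by
    simp only [rowAmplitude_add_smul, hpt]
  have hadd : ∀ {f g : Matrix.unitaryGroup (Fin d) ℂ → ℝ}, Integrable f (haarUnitary d) →
      Integrable g (haarUnitary d) → Integrable (fun U => f U + g U) (haarUnitary d) :=
    fun hf hg => hf.add hg
  rw [integral_add (hadd (hadd (hint _) (hint _)) (hint _)) (hint _),
    integral_add (hadd (hint _) (hint _)) (hint _), integral_add (hint _) (hint _),
    integral_add ((hadd (hint _) (hint _)).const_mul 4) (hint2.const_mul 16),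
    integral_const_mul, integral_const_mul, integral_add (hint _) (hint _)] at hL
  simp only [integral_norm_rowAmplitude_pow_four] at hL
  rw [hvec 1 (by simp), hvec (-1) (by simp), hvec Complex.I (by simp),
    hvec (-Complex.I) (by simp)] at hL
  have h8 := sum_fourth_roots_sq (∑ i, ‖w i‖ ^ 2 + ∑ i, ‖z i‖ ^ 2) (∑ i, star (w i) * z i)
  linear_combination (-1 / 16 : ℝ) * hL + haarFourthMoment b / 16 * h8

/-- By bilinearity in the two spectral decompositions this reduces to pairs of eigenvectors, whose
squared overlaps recombine into `Tr AB`. -/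
theorem integral_bornProb_mul_bornProb_aux {d : ℕ} {A B : Matrix (Fin d) (Fin d) ℂ}
    (hA : A.IsHermitian) (hB : B.IsHermitian) (b : Fin d) :
    ∫ U, bornProb A (U, b) * bornProb B (U, b) ∂haarUnitary d =
      haarFourthMoment b / 2 * (A.trace.re * B.trace.re + (A * B).trace.re) := by
  obtain ⟨W, l, rfl⟩ := hA.exists_unitary_diagonal
  obtain ⟨V, p, rfl⟩ := hB.exists_unitary_diagonal
  have htr : ∀ (W : Matrix.unitaryGroup (Fin d) ℂ) (l : Fin d → ℝ),
      ((W : Matrix (Fin d) (Fin d) ℂ) * Matrix.diagonal (fun i => (l i : ℂ)) *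
        (W : Matrix (Fin d) (Fin d) ℂ).conjTranspose).trace.re = ∑ i, l i := fun W l => by
    rw [trace_conj_unitary, Matrix.trace_diagonal]
    simp
  have htr2 : ((W : Matrix (Fin d) (Fin d) ℂ) * Matrix.diagonal (fun i => (l i : ℂ)) *
        (W : Matrix (Fin d) (Fin d) ℂ).conjTranspose *
      ((V : Matrix (Fin d) (Fin d) ℂ) * Matrix.diagonal (fun i => (p i : ℂ)) *
        (V : Matrix (Fin d) (Fin d) ℂ).conjTranspose)).trace.re =
      ∑ i, ∑ k, l i * p k * ‖∑ j, star ((W : Matrix (Fin d) (Fin d) ℂ) j i) *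
        (V : Matrix (Fin d) (Fin d) ℂ) j k‖ ^ 2 := by
    set X : Matrix (Fin d) (Fin d) ℂ := (W : Matrix (Fin d) (Fin d) ℂ).conjTranspose *
      (V : Matrix (Fin d) (Fin d) ℂ) with hX
    have hrw : ((W : Matrix (Fin d) (Fin d) ℂ) * Matrix.diagonal (fun i => (l i : ℂ)) *
        (W : Matrix (Fin d) (Fin d) ℂ).conjTranspose *
      ((V : Matrix (Fin d) (Fin d) ℂ) * Matrix.diagonal (fun i => (p i : ℂ)) *
        (V : Matrix (Fin d) (Fin d) ℂ).conjTranspose)).trace =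
        (Matrix.diagonal (fun i => (l i : ℂ)) *
          (X * Matrix.diagonal (fun i => (p i : ℂ)) * X.conjTranspose)).trace := by
      rw [hX, Matrix.conjTranspose_mul, Matrix.conjTranspose_conjTranspose]
      simp only [mul_assoc]
      rw [Matrix.trace_mul_comm]
      simp only [mul_assoc]
    rw [hrw]
    simp only [Matrix.trace, Matrix.diag, Matrix.diagonal_mul, Complex.re_sum,
      mul_diagonal_mul_conjTranspose_apply, ← Complex.ofReal_mul, Complex.ofReal_re,
      Finset.mul_sum]
    exact Finset.sum_congr rfl fun i _ => Finset.sum_congr rfl fun k _ => (mul_assoc _ _ _).symm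
  rw [htr, htr, htr2]
  simp only [bornProb_conj_diagonal, mul_apply_eq_rowAmplitude, Finset.sum_mul_sum]
  have hint2 : ∀ w z : Fin d → ℂ, Integrable
      (fun U => ‖rowAmplitude b w U‖ ^ 2 * ‖rowAmplitude b z U‖ ^ 2)
      (haarUnitary d) := fun w z => integrable_haarUnitary
    (((continuous_rowAmplitude b w).norm.pow 2).mul ((continuous_rowAmplitude b z).norm.pow 2))
  simp only [mul_mul_mul_comm (l _)]
  rw [integral_finsetSum _ fun i _ => integrable_finsetSum _ fun k _ => (hint2 _ _).const_mul _]
  rw [← Finset.sum_add_distrib, Finset.mul_sum]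
  refine Finset.sum_congr rfl fun i _ => ?_
  rw [integral_finsetSum _ fun k _ => (hint2 _ _).const_mul _, ← Finset.sum_add_distrib,
    Finset.mul_sum]
  refine Finset.sum_congr rfl fun k _ => ?_
  rw [integral_const_mul, integral_norm_sq_mul_norm_sq_rowAmplitude, sum_norm_sq_col_unitary,
    sum_norm_sq_col_unitary]
  ring

/-- The Haar second moment: `E ⟨v|A|v⟩⟨v|B|v⟩ = (Tr A Tr B + Tr AB) / (d (d + 1))`. -/
theorem integral_bornProb_mul_bornProb {d : ℕ} {A B : Matrix (Fin d) (Fin d) ℂ}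
    (hA : A.IsHermitian) (hB : B.IsHermitian) (b : Fin d) :
    ∫ U, bornProb A (U, b) * bornProb B (U, b) ∂haarUnitary d =
      (A.trace.re * B.trace.re + (A * B).trace.re) / (d * (d + 1)) := by
  -- For `A = B = 1` the left side is 1, which determines `haarFourthMoment b = 2 / (d (d + 1))`.
  have h1 := integral_bornProb_mul_bornProb_aux (A := 1) (B := 1) Matrix.isHermitian_one
    Matrix.isHermitian_one b
  have hb1 : ∀ U : Matrix.unitaryGroup (Fin d) ℂ,
      bornProb (1 : Matrix (Fin d) (Fin d) ℂ) (U, b) = 1 := fun U => by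
    simp [bornProb, self_mul_conjTranspose_unitary]
  have hd : (0 : ℝ) < d := by exact_mod_cast b.pos
  simp only [hb1, mul_one, integral_const, probReal_univ, smul_eq_mul, Matrix.trace_one,
    Fintype.card_fin, Complex.natCast_re] at h1
  rw [integral_bornProb_mul_bornProb_aux hA hB, eq_div_iff (by positivity)]
  linear_combination -(A.trace.re * B.trace.re + (A * B).trace.re) * h1

/-! ### The law of a record -/

theorem bornProb_nonneg {d : ℕ} {ρ : Matrix (Fin d) (Fin d) ℂ} (hρ : IsDensityMatrix ρ)
    (x : ShadowRecord d) : 0 ≤ bornProb ρ x := by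
  have h := (hρ.1.mul_mul_conjTranspose_same (x.1 : Matrix (Fin d) (Fin d) ℂ)).diag_nonneg
    (i := x.2)
  exact (Complex.le_def.mp h).1

theorem sum_bornProb {d : ℕ} (A : Matrix (Fin d) (Fin d) ℂ) (U : Matrix.unitaryGroup (Fin d) ℂ) :
    ∑ b, bornProb A (U, b) = A.trace.re := by
  rw [← trace_conj_unitary U A, Matrix.trace, Complex.re_sum]
  rfl

theorem lintegral_recordLaw {d : ℕ} (ρ : Matrix (Fin d) (Fin d) ℂ) {f : ShadowRecord d → ENNReal}
    (hf : Measurable f) :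
    ∫⁻ x, f x ∂recordLaw ρ =
      ∑ b, ∫⁻ U, ENNReal.ofReal (bornProb ρ (U, b)) * f (U, b) ∂haarUnitary d := by
  have hm : Measurable fun x : ShadowRecord d => ENNReal.ofReal (bornProb ρ x) :=
    ENNReal.measurable_ofReal.comp (continuous_bornProb ρ).measurable
  rw [recordLaw, lintegral_withDensity_eq_lintegral_mul _ hm hf,
    lintegral_prod_symm _ (hm.mul hf).aemeasurable, lintegral_count, tsum_fintype]
  rfl

theorem isProbabilityMeasure_recordLaw {d : ℕ} {ρ : Matrix (Fin d) (Fin d) ℂ}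
    (hρ : IsDensityMatrix ρ) : IsProbabilityMeasure (recordLaw ρ) := by
  refine ⟨?_⟩
  have hm : ∀ b : Fin d, Measurable fun U : Matrix.unitaryGroup (Fin d) ℂ =>
      ENNReal.ofReal (bornProb ρ (U, b)) := fun b =>
    ENNReal.measurable_ofReal.comp
      ((continuous_bornProb ρ).comp (Continuous.prodMk_left b)).measurable
  rw [← lintegral_one, lintegral_recordLaw ρ measurable_const]
  simp only [mul_one]
  rw [← lintegral_finsetSum _ fun b _ => hm b]
  simp only [← ENNReal.ofReal_sum_of_nonneg fun b _ => bornProb_nonneg hρ _, sum_bornProb, hρ.2]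
  simp

theorem integral_recordLaw {d : ℕ} {ρ : Matrix (Fin d) (Fin d) ℂ} (hρ : IsDensityMatrix ρ)
    {f : ShadowRecord d → ℝ} (hf : Continuous f) :
    ∫ x, f x ∂recordLaw ρ = ∑ b, ∫ U, bornProb ρ (U, b) * f (U, b) ∂haarUnitary d := by
  have hm : Measurable fun x : ShadowRecord d => ENNReal.ofReal (bornProb ρ x) :=
    ENNReal.measurable_ofReal.comp (continuous_bornProb ρ).measurable
  have hint : Integrable (fun x => bornProb ρ x * f x) ((haarUnitary d).prod Measure.count) :=
    ((continuous_bornProb ρ).mul hf).integrable_of_hasCompactSupport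
      (HasCompactSupport.of_compactSpace _)
  rw [recordLaw, integral_withDensity_eq_integral_toReal_smul hm
    (Filter.Eventually.of_forall fun _ => ENNReal.ofReal_lt_top)]
  simp only [ENNReal.toReal_ofReal (bornProb_nonneg hρ _), smul_eq_mul]
  rw [integral_prod_symm _ hint, integral_count]

theorem continuous_trace_mul_classicalShadow {d : ℕ} (O : Matrix (Fin d) (Fin d) ℂ) :
    Continuous fun x : ShadowRecord d => (O * classicalShadow x).trace.re := by
  simp only [trace_mul_classicalShadow]
  exact ((continuous_bornProb O).const_mul _).sub continuous_const

theorem IsDensityMatrix.trace_re {d : ℕ} {ρ : Matrix (Fin d) (Fin d) ℂ}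
    (hρ : IsDensityMatrix ρ) : ρ.trace.re = 1 := by rw [hρ.2, Complex.one_re]

theorem IsDensityMatrix.dim_pos {d : ℕ} {ρ : Matrix (Fin d) (Fin d) ℂ}
    (hρ : IsDensityMatrix ρ) : 0 < d := by
  rcases Nat.eq_zero_or_pos d with rfl | h
  · have := hρ.2
    simp [Matrix.trace] at this
  · exact h

/-- The classical shadow is an unbiased estimator of the state. -/
theorem integral_trace_mul_classicalShadow {d : ℕ} {ρ O : Matrix (Fin d) (Fin d) ℂ}
    (hρ : IsDensityMatrix ρ) (hO : O.IsHermitian) :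
    ∫ x, (O * classicalShadow x).trace.re ∂recordLaw ρ = (O * ρ).trace.re := by
  have := isProbabilityMeasure_recordLaw hρ
  have hd : (0 : ℝ) < d := by exact_mod_cast hρ.dim_pos
  simp only [trace_mul_classicalShadow]
  rw [integral_sub, integral_const_mul, integral_recordLaw hρ (continuous_bornProb O)]
  · simp only [integral_bornProb_mul_bornProb hρ.1.1 hO, hρ.trace_re, integral_const,
      probReal_univ, Finset.sum_const, Finset.card_univ, Fintype.card_fin, one_mul, nsmul_eq_mul,
      one_smul, Matrix.trace_mul_comm ρ O]
    field_simp
    ring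
  · exact ((continuous_bornProb O).const_mul _).integrable_of_hasCompactSupport
      (HasCompactSupport.of_compactSpace _)
  · exact integrable_const _

/-- In an eigenbasis of `ρ` the trace is a convex combination of pure-state expectations of `O`. -/
theorem abs_trace_mul_le_hsNorm {d : ℕ} {ρ O : Matrix (Fin d) (Fin d) ℂ}
    (hρ : IsDensityMatrix ρ) (hO : O.IsHermitian) : |(O * ρ).trace.re| ≤ hsNorm O := by
  obtain ⟨V, p, hV⟩ := hρ.1.1.exists_unitary_diagonal
  have hp : ∀ i, 0 ≤ p i := fun i => by
    have h := bornProb_nonneg hρ (V⁻¹, i)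
    rw [hV, bornProb_conj_diagonal, inv_mul_cancel,
      Finset.sum_eq_single i (fun j _ hj => by simp [Matrix.one_apply_ne hj.symm]) (by simp)] at h
    simpa using h
  have hp1 : ∑ i, p i = 1 := by
    have h := hρ.trace_re
    rw [hV, trace_conj_unitary, Matrix.trace_diagonal] at h
    simpa using h
  have htr : (O * ρ).trace.re = ∑ i, p i * bornProb O (V⁻¹, i) := by
    have h : (O * ρ).trace = (Matrix.diagonal (fun i => (p i : ℂ)) *
        ((V : Matrix (Fin d) (Fin d) ℂ).conjTranspose * O *
          (V : Matrix (Fin d) (Fin d) ℂ))).trace := by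
      rw [hV, ← mul_assoc, Matrix.trace_mul_comm, ← mul_assoc, ← mul_assoc, Matrix.trace_mul_comm]
    have hVi : ((V⁻¹ : Matrix.unitaryGroup (Fin d) ℂ) : Matrix (Fin d) (Fin d) ℂ) =
      (V : Matrix (Fin d) (Fin d) ℂ).conjTranspose := rfl
    rw [h]
    simp only [Matrix.trace, Matrix.diag, Matrix.diagonal_mul, Complex.re_sum,
      Complex.re_ofReal_mul, bornProb, hVi, Matrix.conjTranspose_conjTranspose]
  rw [htr]
  calc _ ≤ ∑ i, p i * hsNorm O := by
        refine (Finset.abs_sum_le_sum_abs _ _).trans (Finset.sum_le_sum fun i _ => ?_)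
        rw [abs_mul, abs_of_nonneg (hp i)]
        exact mul_le_mul_of_nonneg_left (abs_bornProb_le_hsNorm hO _) (hp i)
    _ = _ := by rw [← Finset.sum_mul, hp1, one_mul]

/-- The preceding bound with `O = ρ` reads `hsNorm ρ ^ 2 ≤ hsNorm ρ`. -/
theorem trace_mul_self_le_one {d : ℕ} {ρ : Matrix (Fin d) (Fin d) ℂ} (hρ : IsDensityMatrix ρ) :
    (ρ * ρ).trace.re ≤ 1 := by
  have h1 := (le_abs_self _).trans (abs_trace_mul_le_hsNorm hρ hρ.1.1)
  have h2 : hsNorm ρ ^ 2 = (ρ * ρ).trace.re := by rw [hsNorm_sq_eq_trace, hρ.1.1.eq]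
  nlinarith [hsNorm_nonneg ρ]

theorem bornProb_smul {d : ℕ} (c : ℝ) (A : Matrix (Fin d) (Fin d) ℂ) (x : ShadowRecord d) :
    bornProb ((c : ℂ) • A) x = c * bornProb A x := by
  simp [bornProb]

theorem hsNorm_smul {d : ℕ} (c : ℝ) (A : Matrix (Fin d) (Fin d) ℂ) :
    hsNorm ((c : ℂ) • A) = |c| * hsNorm A := by
  rw [← sq_eq_sq₀ (hsNorm_nonneg _) (by have := hsNorm_nonneg A; positivity), mul_pow, sq_abs,
    hsNorm_sq, hsNorm_sq, Finset.mul_sum]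
  simp [Finset.mul_sum, mul_pow]

/-- The Born weight `p` is typically of size `1/d`, so `pE ≤ (d/2) p² + E²/(2d)` is balanced: each
of the `d` outcomes contributes `O(1/d)`, through `E p² ≤ 2/d²` and the Haar exponential moment. -/
theorem lintegral_recordLaw_exp_le {d : ℕ} {ρ O : Matrix (Fin d) (Fin d) ℂ}
    (hρ : IsDensityMatrix ρ) (hO : O.IsHermitian) {s : ℝ} (hs : |s| * hsNorm O ≤ 1 / 4) :
    ∫⁻ x, ENNReal.ofReal (Real.exp (s * (O * classicalShadow x).trace.re)) ∂recordLaw ρ ≤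
      ENNReal.ofReal (5 / 2) := by
  have hd : (0 : ℝ) < d := by exact_mod_cast hρ.dim_pos
  have hcont : Continuous fun x : ShadowRecord d =>
      Real.exp (s * (O * classicalShadow x).trace.re) :=
    Real.continuous_exp.comp ((continuous_trace_mul_classicalShadow O).const_mul s)
  -- The factor 2 comes from squaring the exponential.
  set A : Matrix (Fin d) (Fin d) ℂ := ((2 * s : ℝ) : ℂ) • O with hA
  have hAH : A.IsHermitian := by
    rw [hA, Matrix.IsHermitian, Matrix.conjTranspose_smul, hO.eq]
    simp
  have hAn : hsNorm A ≤ 1 / 2 := by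
    rw [hA, hsNorm_smul, abs_mul, abs_two]
    linarith
  have hAtr : A.trace.re = 2 * s * O.trace.re := by
    rw [hA, Matrix.trace_smul, smul_eq_mul, Complex.re_ofReal_mul]
  have hpt : ∀ x : ShadowRecord d, bornProb ρ x * Real.exp (s * (O * classicalShadow x).trace.re) ≤
      d / 2 * (bornProb ρ x * bornProb ρ x) +
        Real.exp (1 / 2) / (2 * d) * Real.exp (d * bornProb A x - A.trace.re) := by
    intro x
    set E := Real.exp (s * (O * classicalShadow x).trace.re) with hE
    have h1 : E ^ 2 ≤ Real.exp (1 / 2) * Real.exp (d * bornProb A x - A.trace.re) := by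
      rw [hE, ← Real.exp_nat_mul, ← Real.exp_add, Real.exp_le_exp, trace_mul_classicalShadow,
        hAtr]
      -- The estimator carries `d + 1` where the Haar bound has `d`; the surplus is at most `1/2`
      -- and yields the factor `exp (1/2)`.
      have h2 := (le_abs_self _).trans (abs_bornProb_le_hsNorm hAH x)
      rw [hA, bornProb_smul] at *
      push_cast
      linarith
    have h3 : bornProb ρ x * E ≤ d / 2 * (bornProb ρ x * bornProb ρ x) + 1 / (2 * d) * E ^ 2 := by
      have : d / 2 * (bornProb ρ x * bornProb ρ x) + 1 / (2 * d) * E ^ 2 - bornProb ρ x * E =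
          (d * bornProb ρ x - E) ^ 2 / (2 * d) := by
        field_simp
        ring
      have h4 : 0 ≤ (d * bornProb ρ x - E) ^ 2 / (2 * d) := by positivity
      linarith
    calc _ ≤ _ := h3
      _ ≤ d / 2 * (bornProb ρ x * bornProb ρ x) +
          1 / (2 * d) * (Real.exp (1 / 2) * Real.exp (d * bornProb A x - A.trace.re)) := by gcongr
      _ = _ := by ring
  have hslice : ∀ b : Fin d, ∫⁻ U, ENNReal.ofReal (bornProb ρ (U, b)) *
      ENNReal.ofReal (Real.exp (s * (O * classicalShadow (U, b)).trace.re)) ∂haarUnitary d ≤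
      ENNReal.ofReal (5 / 2 / d) := by
    intro b
    have hpc : Continuous fun U : Matrix.unitaryGroup (Fin d) ℂ =>
        bornProb ρ (U, b) * bornProb ρ (U, b) :=
      ((continuous_bornProb ρ).comp (Continuous.prodMk_left b)).mul
        ((continuous_bornProb ρ).comp (Continuous.prodMk_left b))
    have hI : ∫⁻ U, ENNReal.ofReal (bornProb ρ (U, b) * bornProb ρ (U, b)) ∂haarUnitary d ≤
        ENNReal.ofReal (2 / (d * d)) := by
      rw [← ofReal_integral_eq_lintegral_ofReal (integrable_haarUnitary hpc)
        (Filter.Eventually.of_forall fun _ => mul_self_nonneg _),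
        integral_bornProb_mul_bornProb hρ.1.1 hρ.1.1, hρ.trace_re]
      refine ENNReal.ofReal_le_ofReal ?_
      have := trace_mul_self_le_one hρ
      gcongr <;> linarith
    calc _ ≤ ∫⁻ U, (ENNReal.ofReal (d / 2) *
            ENNReal.ofReal (bornProb ρ (U, b) * bornProb ρ (U, b)) +
          ENNReal.ofReal (Real.exp (1 / 2) / (2 * d)) *
            ENNReal.ofReal (Real.exp (d * bornProb A (U, b) - A.trace.re))) ∂haarUnitary d := by
          refine lintegral_mono fun U => ?_
          rw [← ENNReal.ofReal_mul (bornProb_nonneg hρ _), ← ENNReal.ofReal_mul (by positivity),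
            ← ENNReal.ofReal_mul (by positivity), ← ENNReal.ofReal_add
              (mul_nonneg (by positivity) (mul_self_nonneg _)) (by positivity)]
          exact ENNReal.ofReal_le_ofReal (hpt _)
      _ ≤ ENNReal.ofReal (d / 2) * ENNReal.ofReal (2 / (d * d)) +
          ENNReal.ofReal (Real.exp (1 / 2) / (2 * d)) *
            ENNReal.ofReal (Real.exp (hsNorm A ^ 2)) := by
          rw [lintegral_add_left (hpc.measurable.ennreal_ofReal.const_mul _),
            lintegral_const_mul' _ _ ENNReal.ofReal_ne_top,
            lintegral_const_mul' _ _ ENNReal.ofReal_ne_top]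
          gcongr
          exact lintegral_haarUnitary_exp_le hAH hAn b
      _ ≤ _ := by
          rw [← ENNReal.ofReal_mul (by positivity), ← ENNReal.ofReal_mul (by positivity),
            ← ENNReal.ofReal_add (by positivity) (by positivity)]
          refine ENNReal.ofReal_le_ofReal ?_
          have h1 : Real.exp (1 / 2) * Real.exp (hsNorm A ^ 2) ≤ 3 := by
            rw [← Real.exp_add]
            have h2 : 1 / 2 + hsNorm A ^ 2 ≤ 1 := by nlinarith [hsNorm_nonneg A]
            linarith [Real.exp_le_exp.mpr h2, Real.exp_one_lt_d9]
          have h3 : d / 2 * (2 / (d * d)) + Real.exp (1 / 2) / (2 * d) *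
              Real.exp (hsNorm A ^ 2) =
              (1 + Real.exp (1 / 2) * Real.exp (hsNorm A ^ 2) / 2) / (d : ℝ) := by
            field_simp
          rw [h3]
          gcongr
          linarith
  rw [lintegral_recordLaw ρ hcont.measurable.ennreal_ofReal]
  refine (Finset.sum_le_sum fun b _ => hslice b).trans ?_
  rw [Finset.sum_const, Finset.card_univ, Fintype.card_fin, nsmul_eq_mul,
    ← ENNReal.ofReal_natCast, ← ENNReal.ofReal_mul hd.le]
  exact ENNReal.ofReal_le_ofReal (by field_simp; exact le_refl _)

/-- Sub-exponential tails of the single-copy estimator, at the scale of the Hilbert-Schmidt norm. -/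
theorem lintegral_exp_abs_shadow_deviation_le {d : ℕ} {ρ O : Matrix (Fin d) (Fin d) ℂ}
    (hρ : IsDensityMatrix ρ) (hO : O.IsHermitian) (hK : 0 < hsNorm O) :
    ∫⁻ x, ENNReal.ofReal (Real.exp (|(O * classicalShadow x).trace.re - (O * ρ).trace.re| /
      (4 * hsNorm O))) ∂recordLaw ρ ≤ ENNReal.ofReal 7 := by
  set s : ℝ := 1 / (4 * hsNorm O) with hs
  have hs0 : 0 < s := by positivity
  have hsK : s * hsNorm O = 1 / 4 := by rw [hs]; field_simp
  have h1 := lintegral_recordLaw_exp_le hρ hO (s := s) (by rw [abs_of_pos hs0, hsK])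
  have h2 := lintegral_recordLaw_exp_le hρ hO (s := -s) (by rw [abs_neg, abs_of_pos hs0, hsK])
  have hcont : Continuous fun x : ShadowRecord d =>
      Real.exp (s * (O * classicalShadow x).trace.re) :=
    Real.continuous_exp.comp ((continuous_trace_mul_classicalShadow O).const_mul s)
  -- Centring costs `exp (1/4) ≤ 1.4` because `|Tr[Oρ]| ≤ hsNorm O`; then `1.4 * (5/2 + 5/2) = 7`.
  have hpt : ∀ x : ShadowRecord d, Real.exp (|(O * classicalShadow x).trace.re -
      (O * ρ).trace.re| / (4 * hsNorm O)) ≤ 1.4 *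
      (Real.exp (s * (O * classicalShadow x).trace.re) +
        Real.exp (-s * (O * classicalShadow x).trace.re)) := by
    intro x
    set Z := (O * classicalShadow x).trace.re
    have hexp : Real.exp (1 / 4) ≤ 1.4 := by
      refine le_of_pow_le_pow_left₀ (n := 4) (by norm_num) (by norm_num) ?_
      rw [← Real.exp_nat_mul]
      norm_num
      linarith [Real.exp_one_lt_d9]
    have h3 : |Z - (O * ρ).trace.re| / (4 * hsNorm O) ≤ 1 / 4 + |s * Z| := by
      rw [abs_mul, abs_of_pos hs0, ← hsK, div_eq_mul_one_div, ← hs]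
      have := abs_sub Z (O * ρ).trace.re
      nlinarith [abs_trace_mul_le_hsNorm hρ hO]
    refine (Real.exp_le_exp.mpr h3).trans ?_
    rw [Real.exp_add]
    have h4 : Real.exp |s * Z| ≤ Real.exp (s * Z) + Real.exp (-s * Z) := by
      rw [neg_mul]
      rcases abs_cases (s * Z) with ⟨h, _⟩ | ⟨h, _⟩ <;> rw [h] <;>
        linarith [Real.exp_pos (s * Z), Real.exp_pos (-(s * Z))]
    gcongr
  calc _ ≤ ∫⁻ x, ENNReal.ofReal 1.4 * (ENNReal.ofReal
        (Real.exp (s * (O * classicalShadow x).trace.re)) +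
        ENNReal.ofReal (Real.exp (-s * (O * classicalShadow x).trace.re))) ∂recordLaw ρ := by
        refine lintegral_mono fun x => ?_
        rw [← ENNReal.ofReal_add (by positivity) (by positivity),
          ← ENNReal.ofReal_mul (by norm_num)]
        exact ENNReal.ofReal_le_ofReal (hpt x)
    _ ≤ ENNReal.ofReal 1.4 * (ENNReal.ofReal (5 / 2) + ENNReal.ofReal (5 / 2)) := by
        rw [lintegral_const_mul' _ _ ENNReal.ofReal_ne_top,
          lintegral_add_left hcont.measurable.ennreal_ofReal]
        gcongr
    _ = _ := by
        rw [← ENNReal.ofReal_add (by norm_num) (by norm_num), ← ENNReal.ofReal_mul (by norm_num)]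
        norm_num

/-! ### Robustness of the truncated mean -/

/-- The projection of a real number onto `[-T, T]`. -/
noncomputable def clip (T t : ℝ) : ℝ := max (-T) (min t T)

theorem clip_mem_Icc {T : ℝ} (hT : 0 ≤ T) (t : ℝ) : clip T t ∈ Set.Icc (-T) T :=
  ⟨le_max_left _ _, max_le (by linarith) (min_le_right _ _)⟩

theorem abs_clip_le {T : ℝ} (hT : 0 ≤ T) (t : ℝ) : |clip T t| ≤ T :=
  abs_le.mpr (clip_mem_Icc hT t)

theorem clip_eq_self {T t : ℝ} (h : |t| ≤ T) : clip T t = t := by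
  rw [clip, min_eq_left (abs_le.mp h).2, max_eq_right (abs_le.mp h).1]

theorem continuous_clip (T : ℝ) : Continuous (clip T) := by
  unfold clip
  fun_prop

theorem abs_clip_sub_le {T : ℝ} (hT : 0 ≤ T) (t : ℝ) : |clip T t - t| ≤ max 0 (|t| - T) := by
  rcases le_or_gt |t| T with h | h
  · rw [clip_eq_self h, sub_self, abs_zero]
    exact le_max_left _ _
  · refine le_max_of_le_right ?_
    rcases lt_abs.mp h with h1 | h1
    · rw [clip, min_eq_right h1.le, max_eq_right (by linarith), abs_of_neg (by linarith),
        abs_of_pos (by linarith)]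
      linarith
    · rw [clip, min_eq_left (by linarith), max_eq_left (by linarith), abs_of_pos (by linarith),
        abs_of_neg (by linarith)]
      linarith

/-- The ranks discarded by the truncated mean number at most `2 k`. -/
theorem card_discarded_le (n k : ℕ) :
    (Finset.univ.filter fun i : Fin n => ¬(k ≤ (i : ℕ) ∧ (i : ℕ) + k < n)).card ≤ 2 * k := by
  have hsub : (Finset.univ.filter fun i : Fin n => ¬(k ≤ (i : ℕ) ∧ (i : ℕ) + k < n)) ⊆
      (Finset.univ.filter fun i : Fin n => (i : ℕ) < k) ∪
        (Finset.univ.filter fun i : Fin n => n ≤ (i : ℕ) + k) := by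
    intro i
    simp only [Finset.mem_filter, Finset.mem_univ, true_and, Finset.mem_union]
    omega
  have h1 : (Finset.univ.filter fun i : Fin n => (i : ℕ) < k).card ≤ k := by
    conv_rhs => rw [← Finset.card_range k]
    exact Finset.card_le_card_of_injOn (fun i => (i : ℕ)) (fun i hi => by simpa using hi)
      fun i _ j _ h => Fin.ext h
  have h2 : (Finset.univ.filter fun i : Fin n => n ≤ (i : ℕ) + k).card ≤ k := by
    conv_rhs => rw [← Finset.card_range k]
    refine Finset.card_le_card_of_injOn (fun i => n - 1 - (i : ℕ)) (fun i hi => ?_)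
      fun i _ j _ h => Fin.ext ?_
    · have hi' : n ≤ (i : ℕ) + k := by simpa using hi
      have := i.2
      simp only [Finset.coe_range, Set.mem_Iio]
      omega
    · have := i.2
      have := j.2
      dsimp only at h
      omega
  have := (Finset.card_le_card hsub).trans (Finset.card_union_le _ _)
  omega

/-- If at most `k` samples are outliers, the samples kept by the truncated mean are not. -/
theorem abs_sort_sub_le {n k : ℕ} (y : Fin n → ℝ) {μ T : ℝ}
    (hbad : (Finset.univ.filter fun i => T < |y i - μ|).card ≤ k) {i : Fin n}
    (hi : k ≤ (i : ℕ) ∧ (i : ℕ) + k < n) : |y (Tuple.sort y i) - μ| ≤ T := by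
  by_contra hc
  rw [not_le] at hc
  have hmono : Monotone (y ∘ Tuple.sort y) := Tuple.monotone_sort y
  have hcontra : ∀ s : Finset (Fin n), (∀ j ∈ s, T < |y (Tuple.sort y j) - μ|) → s.card ≤ k := by
    intro s hs
    refine le_trans ?_ hbad
    refine Finset.card_le_card_of_injOn (Tuple.sort y) (fun j hj => ?_)
      (Tuple.sort y).injective.injOn
    simpa using hs j hj
  rcases lt_abs.mp hc with h | h
  -- If a kept value were too large, so would be the `n - i > k` values of rank at least `i`; if too
  -- small, the `i + 1 > k` values of rank at most `i`.
  · have := hcontra (Finset.Ici i) fun j hj => by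
      have h2 : y (Tuple.sort y i) ≤ y (Tuple.sort y j) := hmono (Finset.mem_Ici.mp hj)
      exact lt_abs.mpr (Or.inl (by linarith))
    rw [Fin.card_Ici] at this
    omega
  · have := hcontra (Finset.Iic i) fun j hj => by
      have h2 : y (Tuple.sort y j) ≤ y (Tuple.sort y i) := hmono (Finset.mem_Iic.mp hj)
      exact lt_abs.mpr (Or.inr (by linarith))
    rw [Fin.card_Iic] at this
    omega

/-- A corruption changes a sum of clipped samples by at most `2 T` per corrupted sample. -/
theorem abs_sum_clip_sub_le {n : ℕ} {γ : ℝ} {x y : Fin n → ℝ} {μ T : ℝ} (hT : 0 ≤ T)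
    (hc : IsCorruption γ x y) :
    |∑ i, clip T (y i - μ) - ∑ i, clip T (x i - μ)| ≤ 2 * T * (γ * n) := by
  classical
  have hcard : ((Finset.univ.filter fun i => y i ≠ x i).card : ℝ) ≤ γ * n := by
    rw [IsCorruption, Set.ncard_eq_toFinset_card'] at hc
    convert hc using 3
    ext i
    simp
  rw [← Finset.sum_sub_distrib]
  calc _ ≤ ∑ i, if y i ≠ x i then 2 * T else 0 := by
        refine (Finset.abs_sum_le_sum_abs _ _).trans (Finset.sum_le_sum fun i _ => ?_)
        split_ifs with h
        · have h1 := abs_le.mp (abs_clip_le hT (y i - μ))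
          have h2 := abs_le.mp (abs_clip_le hT (x i - μ))
          exact abs_le.mpr ⟨by linarith, by linarith⟩
        · rw [not_not.mp h, sub_self, abs_zero]
    _ = (Finset.univ.filter fun i => y i ≠ x i).card * (2 * T) := by
        rw [← Finset.sum_filter, Finset.sum_const, nsmul_eq_mul]
    _ ≤ γ * n * (2 * T) := by gcongr
    _ = _ := by ring

/-- Few outliers and a concentrated clipped mean of the honest samples bound the error of the
truncated mean under corruption. -/
theorem abs_truncatedMean_sub_le {n : ℕ} {γ : ℝ} (hγ : 0 < γ) (hγ4 : γ < 1 / 4) (hn : 0 < n)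
    {x y : Fin n → ℝ} {μ T η : ℝ} (hT : 0 ≤ T) (hc : IsCorruption γ x y)
    (hbig : ∑ i, (if T < |x i - μ| then (1 : ℝ) else 0) ≤ γ * n)
    (hmean : |∑ i, clip T (x i - μ)| ≤ n * η) :
    |truncatedMean (2 * γ) y - μ| ≤ 12 * γ * T + 2 * η := by
  classical
  have hn' : (0 : ℝ) < n := by exact_mod_cast hn
  have hη : 0 ≤ η := by
    have := (abs_nonneg _).trans hmean
    exact nonneg_of_mul_nonneg_right this hn'
  set k : ℕ := ⌊2 * γ * n⌋₊ with hk
  have hk1 : (k : ℝ) ≤ 2 * γ * n := Nat.floor_le (by positivity)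
  set kept : Finset (Fin n) := Finset.univ.filter fun i => k ≤ (i : ℕ) ∧ (i : ℕ) + k < n with hkept
  have hdisc := card_discarded_le n k
  have hcards : kept.card +
      (Finset.univ.filter fun i : Fin n => ¬(k ≤ (i : ℕ) ∧ (i : ℕ) + k < n)).card = n := by
    rw [Finset.card_filter_add_card_filter_not, Finset.card_univ, Fintype.card_fin]
  have hkn : (n : ℝ) - 2 * k ≤ kept.card := by
    have : n ≤ kept.card + 2 * k := by omega
    have : (n : ℝ) ≤ kept.card + 2 * k := by exact_mod_cast this
    linarith
  have hkpos : (0 : ℝ) < kept.card := by nlinarith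
  -- Outliers are corrupted (at most `γ n`) or honest (at most `γ n`): this is why the truncation
  -- level is `2γ`. The count is an integer, so the floor loses nothing.
  have hbad : (Finset.univ.filter fun i => T < |y i - μ|).card ≤ k := by
    rw [hk]
    refine Nat.le_floor ?_
    have hsub : (Finset.univ.filter fun i => T < |y i - μ|) ⊆
        (Finset.univ.filter fun i => y i ≠ x i) ∪ (Finset.univ.filter fun i => T < |x i - μ|) := by
      intro i
      simp only [Finset.mem_filter, Finset.mem_univ, true_and, Finset.mem_union]
      intro h
      by_cases hxy : y i = x i
      · exact Or.inr (hxy ▸ h)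
      · exact Or.inl hxy
    have h1 : ((Finset.univ.filter fun i => y i ≠ x i).card : ℝ) ≤ γ * n := by
      rw [IsCorruption, Set.ncard_eq_toFinset_card'] at hc
      convert hc using 3
      ext i
      simp
    have h2 : ((Finset.univ.filter fun i => T < |x i - μ|).card : ℝ) ≤ γ * n := by
      rwa [Finset.sum_boole] at hbig
    have h3 : ((Finset.univ.filter fun i => T < |y i - μ|).card : ℝ) ≤
        (Finset.univ.filter fun i => y i ≠ x i).card +
          (Finset.univ.filter fun i => T < |x i - μ|).card := by
      exact_mod_cast (Finset.card_le_card hsub).trans (Finset.card_union_le _ _)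
    linarith
  have hkeptT : ∀ i ∈ kept, |y (Tuple.sort y i) - μ| ≤ T := fun i hi =>
    abs_sort_sub_le y hbad (Finset.mem_filter.mp hi).2
  have herr : truncatedMean (2 * γ) y - μ =
      (∑ i ∈ kept, (y (Tuple.sort y i) - μ)) / kept.card := by
    rw [Finset.sum_sub_distrib, Finset.sum_const, nsmul_eq_mul, sub_div,
      mul_div_cancel_left₀ _ hkpos.ne']
    rfl
  rw [herr, abs_div, abs_of_pos hkpos, div_le_iff₀ hkpos]
  -- For `γ ≥ 1/8` the trivial bound `T ≤ 12 γ T` suffices; otherwise at least `n / 2` samples are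
  -- kept.
  rcases le_or_gt (1 / 8) γ with h8 | h8
  · calc _ ≤ ∑ i ∈ kept, T :=
          (Finset.abs_sum_le_sum_abs _ _).trans (Finset.sum_le_sum hkeptT)
      _ = T * kept.card := by rw [Finset.sum_const, nsmul_eq_mul, mul_comm]
      _ ≤ _ := by
          gcongr
          nlinarith
  · have hsplit := Finset.sum_filter_add_sum_filter_not Finset.univ
      (fun i : Fin n => k ≤ (i : ℕ) ∧ (i : ℕ) + k < n)
      (fun i => clip T (y (Tuple.sort y i) - μ))
    rw [Equiv.sum_comp (Tuple.sort y) fun i => clip T (y i - μ)] at hsplit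
    have hk2 : ∑ i ∈ kept, (y (Tuple.sort y i) - μ) =
        ∑ i ∈ kept, clip T (y (Tuple.sort y i) - μ) :=
      Finset.sum_congr rfl fun i hi => (clip_eq_self (hkeptT i hi)).symm
    have hout : |∑ i ∈ Finset.univ.filter fun i : Fin n => ¬(k ≤ (i : ℕ) ∧ (i : ℕ) + k < n),
        clip T (y (Tuple.sort y i) - μ)| ≤ 2 * k * T := by
      refine (Finset.abs_sum_le_sum_abs _ _).trans ((Finset.sum_le_sum fun i _ =>
        abs_clip_le hT _).trans ?_)
      rw [Finset.sum_const, nsmul_eq_mul]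
      gcongr
      exact_mod_cast hdisc
    have hcorr := abs_sum_clip_sub_le (μ := μ) hT hc
    have hn2 : (n : ℝ) / 2 ≤ kept.card := by nlinarith
    have hkT : 2 * k * T ≤ 4 * γ * n * T := by nlinarith
    rw [hk2, eq_sub_of_add_eq hsplit]
    -- Corruption costs `2γnT`, trimming `4γnT` and the honest fluctuation `nη`; dividing by at
    -- least `n / 2` doubles the coefficients.
    have hsum : (n : ℝ) * (6 * γ * T + η) ≤ (12 * γ * T + 2 * η) * kept.card := by
      have : 0 ≤ 6 * γ * T + η := by positivity
      nlinarith
    refine le_trans ?_ hsum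
    rw [abs_le] at *
    constructor <;> linarith [hcorr.1, hcorr.2, hout.1, hout.2, hmean.1, hmean.2]

/-! ### Concentration of the honest samples -/

theorem measure_pi_sum_sub_integral_ge_le {α : Type*} [MeasurableSpace α] (ν : Measure α)
    [IsProbabilityMeasure ν] {n : ℕ} {f : α → ℝ} (hf : Measurable f) {a b ε : ℝ}
    (hn : 0 < n) (hfab : ∀ x, f x ∈ Set.Icc a b) (hε : 0 ≤ ε) :
    Measure.pi (fun _ : Fin n => ν) {x | n * ε ≤ ∑ i, (f (x i) - ∫ z, f z ∂ν)} ≤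
      ENNReal.ofReal (Real.exp (-(2 * n * ε ^ 2 / (b - a) ^ 2))) := by
  have hsub := hasSubgaussianMGF_of_mem_Icc hf.aemeasurable (Filter.Eventually.of_forall hfab)
    (μ := ν)
  have hi : iIndepFun (fun (i : Fin n) (x : Fin n → α) => f (x i) - ∫ z, f z ∂ν)
      (Measure.pi fun _ : Fin n => ν) :=
    iIndepFun_pi (X := fun _ z => f z - ∫ z, f z ∂ν) fun _ => (hf.sub_const _).aemeasurable
  have hsubi : ∀ i : Fin n, HasSubgaussianMGF (fun x : Fin n → α => f (x i) - ∫ z, f z ∂ν)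
      ((‖b - a‖₊ / 2) ^ 2) (Measure.pi fun _ : Fin n => ν) := fun i => by
    refine HasSubgaussianMGF.of_map (Y := fun x : Fin n → α => x i)
      (X := fun z => f z - ∫ z, f z ∂ν) (measurable_pi_apply i).aemeasurable ?_
    rwa [(measurePreserving_eval (fun _ : Fin n => ν) i).map_eq]
  have h := HasSubgaussianMGF.measure_sum_ge_le_of_iIndepFun hi (s := Finset.univ)
    (fun i _ => hsubi i) (ε := n * ε) (by positivity)
  rw [← ofReal_measureReal]
  refine ENNReal.ofReal_le_ofReal (h.trans_eq ?_)
  congr 1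
  have hn' : (n : ℝ) ≠ 0 := by exact_mod_cast hn.ne'
  simp only [Finset.sum_const, Finset.card_univ, Fintype.card_fin, nsmul_eq_mul]
  push_cast
  rw [Real.norm_eq_abs, div_pow, sq_abs]
  -- When `a = b`, division by zero gives exponent `0`, so the two expressions still agree.
  rcases eq_or_ne ((b - a) ^ 2) 0 with h0 | h0
  · simp [h0]
  · field_simp

/-- For i.i.d. samples with sub-exponential tails, with high probability the `2γ`-truncated mean
of every `γ`-corruption is within `O(γ log(1/γ))` of the mean. -/
theorem exists_bad_set_truncatedMean {α : Type*} [MeasurableSpace α] (ν : Measure α)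
    [IsProbabilityMeasure ν] {n : ℕ} (hn : 0 < n) {γ : ℝ} (hγ : 0 < γ) (hγ4 : γ < 1 / 4)
    {Z : α → ℝ} (hZ : Measurable Z) (hZi : Integrable Z ν) {L : ℝ} (hL : 0 < L)
    (hexp : ∫⁻ z, ENNReal.ofReal (Real.exp (|Z z - ∫ w, Z w ∂ν| / L)) ∂ν ≤ ENNReal.ofReal 7) :
    ∃ B : Set (Fin n → α), Measure.pi (fun _ : Fin n => ν) B ≤
        ENNReal.ofReal (3 * Real.exp (-(n * γ ^ 2 / 2))) ∧
      ∀ x ∉ B, ∀ y : Fin n → ℝ, IsCorruption γ (fun i => Z (x i)) y →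
        |truncatedMean (2 * γ) y - ∫ w, Z w ∂ν| ≤ 45 * γ * Real.log (1 / γ) * L := by
  set μ := ∫ w, Z w ∂ν with hμ
  -- Chosen so that `exp (-T₀) = γ³`, and `7γ³ ≤ γ/2` for `γ < 1/4`.
  set T₀ : ℝ := 3 * Real.log (1 / γ) with hT₀
  set T : ℝ := L * T₀ with hT
  have hlog : 1 ≤ Real.log (1 / γ) := by
    rw [Real.le_log_iff_exp_le (by positivity)]
    have h4 : 4 ≤ 1 / γ := by rw [le_div_iff₀ hγ]; linarith
    linarith [Real.exp_one_lt_d9]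
  have hT0 : 0 < T := by positivity
  have hexpT : Real.exp (-T₀) = γ ^ 3 := by
    rw [hT₀, one_div, Real.log_inv, mul_neg, neg_neg, ← Real.log_rpow hγ, Real.exp_log (by positivity)]
    norm_cast
  have hem : Measurable fun z => Real.exp (|Z z - μ| / L) := by fun_prop
  have hei : Integrable (fun z => Real.exp (|Z z - μ| / L)) ν := by
    refine ⟨hem.aestronglyMeasurable, ?_⟩
    rw [hasFiniteIntegral_iff_ofReal (Filter.Eventually.of_forall fun _ => (Real.exp_pos _).le)]
    exact hexp.trans_lt ENNReal.ofReal_lt_top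
  have heI : ∫ z, Real.exp (|Z z - μ| / L) ∂ν ≤ 7 := by
    rw [integral_eq_lintegral_of_nonneg_ae
      (Filter.Eventually.of_forall fun _ => (Real.exp_pos _).le) hem.aestronglyMeasurable]
    exact ENNReal.toReal_le_of_le_ofReal (by norm_num) hexp
  have hγ3 : 7 * γ ^ 3 ≤ γ / 2 := by nlinarith [mul_pos hγ hγ, mul_pos hγ (mul_pos hγ hγ)]
  have hshift : ∀ z, Real.exp (|Z z - μ| / L - T₀) = γ ^ 3 * Real.exp (|Z z - μ| / L) := fun z => by
    rw [sub_eq_add_neg, Real.exp_add, hexpT, mul_comm]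
  have hshiftI : ∫ z, Real.exp (|Z z - μ| / L - T₀) ∂ν ≤ γ / 2 := by
    simp only [hshift]
    rw [integral_const_mul]
    nlinarith [pow_pos hγ 3]
  have hshifti : Integrable (fun z => Real.exp (|Z z - μ| / L - T₀)) ν := by
    simp only [hshift]
    exact hei.const_mul _
  set ind : α → ℝ := fun z => if T < |Z z - μ| then 1 else 0 with hind
  have hindm : Measurable ind :=
    Measurable.ite (measurableSet_lt measurable_const (by fun_prop)) measurable_const
      measurable_const
  have hind01 : ∀ z, ind z ∈ Set.Icc (0 : ℝ) 1 := fun z => by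
    simp only [hind]
    split_ifs <;> simp
  have hindI : ∫ z, ind z ∂ν ≤ γ / 2 := by
    refine le_trans (integral_mono (Integrable.of_mem_Icc 0 1 hindm.aemeasurable
      (Filter.Eventually.of_forall hind01)) hshifti fun z => ?_) hshiftI
    simp only [hind]
    split_ifs with h
    · rw [Real.one_le_exp_iff, sub_nonneg, le_div_iff₀ hL, mul_comm]
      exact h.le
    · positivity
  set cl : α → ℝ := fun z => clip T (Z z - μ) with hcl
  have hclm : Measurable cl := (continuous_clip T).measurable.comp (hZ.sub_const μ)
  have hclT : ∀ z, cl z ∈ Set.Icc (-T) T := fun z => clip_mem_Icc hT0.le _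
  have hcli : Integrable cl ν := Integrable.of_mem_Icc (-T) T hclm.aemeasurable
    (Filter.Eventually.of_forall hclT)
  -- The clipping bias is at most the mean excess over `T`, and `s ≤ exp s` bounds this by the same
  -- shifted exponential moment as the outlier probability.
  have hclI : |∫ z, cl z ∂ν| ≤ L * (γ / 2) := by
    have h0 : ∫ z, (Z z - μ) ∂ν = 0 := by
      rw [integral_sub hZi (integrable_const _), integral_const, probReal_univ, one_smul, hμ,
        sub_self]
    have hZμ : Integrable (fun z => Z z - μ) ν := hZi.sub (integrable_const _)
    have h1 : ∫ z, cl z ∂ν = ∫ z, (cl z - (Z z - μ)) ∂ν := by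
      rw [integral_sub hcli hZμ, h0, sub_zero]
    rw [h1]
    refine (abs_integral_le_integral_abs).trans ?_
    calc _ ≤ ∫ z, L * Real.exp (|Z z - μ| / L - T₀) ∂ν := by
          refine integral_mono (hcli.sub hZμ).abs (hshifti.const_mul L) fun z => ?_
          refine (abs_clip_sub_le hT0.le _).trans (max_le (by positivity) ?_)
          have h2 := Real.add_one_le_exp (|Z z - μ| / L - T₀)
          have h3 : |Z z - μ| - T = L * (|Z z - μ| / L - T₀) := by rw [hT]; field_simp
          rw [h3]
          gcongr
          linarith
      _ ≤ _ := by
          rw [integral_const_mul]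
          gcongr
  have hn' : (0 : ℝ) < n := by exact_mod_cast hn
  -- Slack `γ/2` for range 1 and slack `γT` for range `2T` give the same exponent `n γ² / 2`.
  have hB1 := measure_pi_sum_sub_integral_ge_le ν hindm hn hind01 (ε := γ / 2) (by positivity)
  have hB2 := measure_pi_sum_sub_integral_ge_le ν hclm hn hclT (ε := γ * T) (by positivity)
  have hB3 := measure_pi_sum_sub_integral_ge_le ν hclm.neg hn (a := -T) (b := T)
    (fun z => ⟨neg_le_neg (hclT z).2, neg_le.mp (hclT z).1⟩) (ε := γ * T) (by positivity)
  have he1 : 2 * n * (γ / 2) ^ 2 / (1 - 0) ^ 2 = n * γ ^ 2 / 2 := by ring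
  have he2 : 2 * n * (γ * T) ^ 2 / (T - -T) ^ 2 = n * γ ^ 2 / 2 := by
    field_simp
    ring
  rw [he1] at hB1
  rw [he2] at hB2 hB3
  refine ⟨_, (measure_union_le _ _).trans (add_le_add ((measure_union_le _ _).trans
    (add_le_add hB1 hB2)) hB3) |>.trans_eq ?_, fun x hx y hy => ?_⟩
  · rw [← ENNReal.ofReal_add (by positivity) (by positivity),
      ← ENNReal.ofReal_add (by positivity) (by positivity)]
    congr 1
    ring
  · simp only [Set.mem_union, Set.mem_ofPred_eq, not_or, not_le, Finset.sum_sub_distrib,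
      Finset.sum_const, Finset.card_univ, Fintype.card_fin, nsmul_eq_mul, Pi.neg_apply,
      Finset.sum_neg_distrib, integral_neg] at hx
    obtain ⟨⟨hx1, hx2⟩, hx3⟩ := hx
    have hbig : ∑ i, (if T < |Z (x i) - μ| then (1 : ℝ) else 0) ≤ γ * n := by
      have : ∑ i, ind (x i) ≤ γ * n := by nlinarith
      exact this
    have hclI' := abs_le.mp hclI
    have hmean : |∑ i, clip T (Z (x i) - μ)| ≤ n * (γ * T + L * (γ / 2)) := by
      have : |∑ i, cl (x i)| ≤ n * (γ * T + L * (γ / 2)) := by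
        rw [abs_le]
        constructor <;> nlinarith
      exact this
    refine (abs_truncatedMean_sub_le hγ hγ4 hn hT0.le hy hbig hmean).trans ?_
    -- With `η = γT + Lγ/2` the error is `14γT + Lγ ≤ 15γT`, and `T = 3 L log(1/γ)` gives 45.
    have h1 : L * γ ≤ γ * T := by
      rw [hT]
      have : 1 ≤ T₀ := by linarith
      nlinarith [mul_pos hL hγ]
    calc _ ≤ 15 * (γ * T) := by linarith
      _ = _ := by rw [hT, hT₀]; ring

theorem truncatedMean_zero {n : ℕ} (ξ : ℝ) : truncatedMean ξ (fun _ : Fin n => (0 : ℝ)) = 0 := by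
  simp [truncatedMean]

theorem IsCorruption.comp {α β : Type*} {n : ℕ} {γ : ℝ} {x y : Fin n → α}
    (h : IsCorruption γ x y) (f : α → β) :
    IsCorruption γ (fun i => f (x i)) (fun i => f (y i)) := by
  refine le_trans ?_ h
  have hsub : ({i | f (y i) ≠ f (x i)} : Set (Fin n)) ⊆ {i | y i ≠ x i} :=
    fun i (hi : f (y i) ≠ f (x i)) hxy => hi (congrArg f hxy)
  exact_mod_cast Set.ncard_le_ncard hsub (Set.toFinite _)

/-- The bad set is chosen before `y`, so an adversary who sees all of `x` gains nothing. Scale `4 *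
hsNorm O` turns 45 into 180; `hsNorm O = 0`, where this scale degenerates, is treated apart. -/
theorem exists_bad_set_robustShadowEstimate {d n : ℕ} (hn : 0 < n) {γ : ℝ} (hγ : 0 < γ)
    (hγ4 : γ < 1 / 4) {ρ O : Matrix (Fin d) (Fin d) ℂ} (hρ : IsDensityMatrix ρ)
    (hO : O.IsHermitian) :
    ∃ B : Set (Fin n → ShadowRecord d), Measure.pi (fun _ : Fin n => recordLaw ρ) B ≤
        ENNReal.ofReal (3 * Real.exp (-(n * γ ^ 2 / 2))) ∧
      ∀ x ∉ B, ∀ y, IsCorruption γ x y →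
        |robustShadowEstimate γ O y - (O * ρ).trace.re| ≤
          180 * γ * Real.log (1 / γ) * hsNorm O := by
  have := isProbabilityMeasure_recordLaw hρ
  rcases (hsNorm_nonneg O).eq_or_lt with h | h
  · refine ⟨∅, by simp, fun x _ y _ => ?_⟩
    rw [← h, eq_zero_of_hsNorm_eq_zero h.symm]
    simp [robustShadowEstimate, truncatedMean_zero]
  · have hc := continuous_trace_mul_classicalShadow O
    have hexp := lintegral_exp_abs_shadow_deviation_le hρ hO h
    rw [← integral_trace_mul_classicalShadow hρ hO] at hexp ⊢
    obtain ⟨B, hB, hgood⟩ := exists_bad_set_truncatedMean (recordLaw ρ) hn hγ hγ4 hc.measurable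
      (hc.integrable_of_hasCompactSupport (HasCompactSupport.of_compactSpace _))
      (L := 4 * hsNorm O) (by positivity) hexp
    refine ⟨B, hB, fun x hx y hy => ?_⟩
    have hest := hgood x hx _ (hy.comp fun r => (O * classicalShadow r).trace.re)
    rw [show 180 * γ * Real.log (1 / γ) * hsNorm O =
      45 * γ * Real.log (1 / γ) * (4 * hsNorm O) by ring]
    exact hest

theorem mainTheorem1 :
    ∃ C₁ > (0 : ℝ), ∃ C₂ > (0 : ℝ),
      ∀ (d M n : ℕ) (γ δ : ℝ), 0 < M → 0 < γ → γ < 1 / 4 → 0 < δ → δ < 1 → 2 * δ ≤ M →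
        C₁ * Real.log (M / δ) / γ ^ 2 ≤ n →
      ∀ O : Fin M → Matrix (Fin d) (Fin d) ℂ, (∀ i, (O i).IsHermitian) →
      ∀ ρ : Matrix (Fin d) (Fin d) ℂ, IsDensityMatrix ρ →
      -- the honest records `X` of the `n` copies, and the records `Y` that a (possibly
      -- randomized) adversary with full knowledge of `X` hands to the algorithm
      ∀ (Ω : Type*) [MeasurableSpace Ω] (P : Measure Ω) [IsProbabilityMeasure P]
        (X Y : Ω → Fin n → ShadowRecord d),
        HasLaw X (Measure.pi fun _ : Fin n => recordLaw ρ) P →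
        (∀ᵐ ω ∂P, IsCorruption γ (X ω) (Y ω)) →
        P {ω | ¬ ∀ i, |robustShadowEstimate γ (O i) (Y ω) - (O i * ρ).trace.re| ≤
            C₂ * γ * Real.log (1 / γ) * ⨆ j, hsNorm (O j)} ≤ ENNReal.ofReal δ := by
  -- With 6 the exponent `n γ² / 2` is at least `3 log(M/δ)`, so the union bound gives `3 (δ/M)² δ ≤
  -- δ`, using `δ/M ≤ 1/2`.
  refine ⟨6, by norm_num, 180, by norm_num, ?_⟩
  intro d M n γ δ hM hγ hγ4 hδ _ hMδ hnC O hO ρ hρ Ω _ P _ X Y hX hXY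
  have hM' : (0 : ℝ) < M := by exact_mod_cast hM
  have hratio : 2 ≤ M / δ := by rwa [le_div_iff₀ hδ]
  have hlogpos : 0 < Real.log (M / δ) := Real.log_pos (by linarith)
  have hn : 0 < n := by
    have : (0 : ℝ) < n := lt_of_lt_of_le (by positivity) hnC
    exact_mod_cast this
  have hlogγ : 0 ≤ Real.log (1 / γ) := by
    refine Real.log_nonneg ?_
    rw [le_div_iff₀ hγ]
    linarith
  choose B hB hgood using fun i => exists_bad_set_robustShadowEstimate hn hγ hγ4 hρ (hO i)
  have hsub : {ω | ¬ ∀ i, |robustShadowEstimate γ (O i) (Y ω) - (O i * ρ).trace.re| ≤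
      180 * γ * Real.log (1 / γ) * ⨆ j, hsNorm (O j)} ⊆
      {ω | ¬ IsCorruption γ (X ω) (Y ω)} ∪ X ⁻¹' (⋃ i, B i) := by
    intro ω hω
    by_contra hc
    simp only [Set.mem_union, Set.mem_ofPred_eq, Set.mem_preimage, Set.mem_iUnion, not_or, not_not,
      not_exists] at hc
    refine hω fun i => (hgood i (X ω) (hc.2 i) (Y ω) hc.1).trans ?_
    gcongr
    exact le_ciSup (f := fun j => hsNorm (O j)) (Set.finite_range _).bddAbove i
  have hnγ : 6 * Real.log (M / δ) ≤ n * γ ^ 2 := (div_le_iff₀ (by positivity)).mp hnC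
  calc _ ≤ P {ω | ¬ IsCorruption γ (X ω) (Y ω)} + P (X ⁻¹' (⋃ i, B i)) :=
        (measure_mono hsub).trans (measure_union_le _ _)
    _ ≤ 0 + Measure.pi (fun _ : Fin n => recordLaw ρ) (⋃ i, B i) := by
        refine add_le_add (le_of_eq (ae_iff.mp hXY)) ?_
        rw [← hX.map_eq]
        -- This inequality holds for arbitrary sets, so the bad sets need not be measurable.
        exact Measure.le_map_apply hX.aemeasurable _
    _ ≤ ∑ _i : Fin M, ENNReal.ofReal (3 * Real.exp (-(n * γ ^ 2 / 2))) := by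
        rw [zero_add]
        exact (measure_iUnion_fintype_le _ _).trans (Finset.sum_le_sum fun i _ => hB i)
    _ = ENNReal.ofReal (M * (3 * Real.exp (-(n * γ ^ 2 / 2)))) := by
        rw [Finset.sum_const, Finset.card_univ, Fintype.card_fin, nsmul_eq_mul,
          ENNReal.ofReal_mul hM'.le, ENNReal.ofReal_natCast]
    _ ≤ ENNReal.ofReal δ := by
        refine ENNReal.ofReal_le_ofReal ?_
        have h1 : Real.exp (-(n * γ ^ 2 / 2)) ≤ (δ / M) ^ 3 := by
          have h2 : (δ / M) ^ 3 = Real.exp (-(3 * Real.log (M / δ))) := by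
            rw [← mul_neg, ← Real.log_inv, inv_div]
            have h3 := Real.exp_nat_mul (Real.log (δ / M)) 3
            rw [Real.exp_log (by positivity)] at h3
            rw [← h3]
            norm_num
          rw [h2, Real.exp_le_exp]
          linarith
        have h4 : δ / M ≤ 1 / 2 := by
          rw [div_le_iff₀ hM']
          linarith
        have h5 : 0 < δ / M := by positivity
        calc _ ≤ M * (3 * (δ / M) ^ 3) := by gcongr
          _ = 3 * (δ / M) ^ 2 * δ := by field_simp
          _ ≤ 1 * δ := by
            gcongr
            nlinarith
          _ = δ := one_mul δ
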